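/- All graphs are finite and loopless; parallel edges are allowed. A connected graph with at least four vertices is matching covered if every edge lies in some perfect matching; it is minimal if, for every edge $e$, the graph $G-e$ is not matching covered. Let $\mathcal{H}_2$ be the class of minimal bipartite matching covered graphs $G$ with exactly $2(m-n+2)$ vertices of degree two, where $n=|V(G)|$ and $m=|E(G)|$. A $3$-edge of $G$ is an edge both of whose ends have degree at least three in $G$. For $W\subseteq V(G)$, let $\partial(W)$ be the set of edges with exactly one end in $W$; for a bipartite graph with colour classes $A$ and $B$, let $\partial^A(W)$ (respectively $\partial^B(W)$) be the set of edges of $\partial(W)$ whose end in $W$ belongs to $A$ (respectively $B$). The cut $\partial(W)$ is balanced if $|\partial^A(W)|=|\partial^B(W)|$. Theorem (Balanced $2$-cut Property). Let $G\in\mathcal{H}_2$ have colour classes $A$ and $B$, and let $e$ be a $3$-edge of $G$. Then there exist a $3$-edge $f\neq e$ of $G$ and a set $W\subseteq V(G)$ such that $\partial(W)=\{e,f\}$ and this cut is balanced, that is, $|\partial^A(W)|=|\partial^B(W)|=1$. -/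

import Mathlib

open scoped Graph

/-! Graphs are finite loopless multigraphs, modelled by Mathlib's `Graph α β`. -/

namespace Graph

variable {α β : Type*}

/-- The degree of a vertex: the number of incident edges, loops being counted twice. -/
noncomputable def degree (G : Graph α β) (v : α) : ℕ :=
  (G.incidenceSet v).ncard + (G.loopSet v).ncard

/-- A graph is connected if it has a vertex and any two vertices are joined by a walk. -/
def IsConnected (G : Graph α β) : Prop :=
  V(G).Nonempty ∧ ∀ x ∈ V(G), ∀ y ∈ V(G), Relation.ReflTransGen G.Adj x y

/-- A perfect matching of a loopless graph: a set of edges meeting each vertex exactly once. -/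
def IsPerfectMatching (G : Graph α β) (M : Set β) : Prop :=
  M ⊆ E(G) ∧ ∀ v ∈ V(G), ∃! e, e ∈ M ∧ G.Inc e v

/-- A graph is matching covered if it is connected, has at least four vertices, and each of its
edges lies in some perfect matching. -/
structure IsMatchingCovered (G : Graph α β) : Prop where
  connected : G.IsConnected
  four_le_order : 4 ≤ V(G).ncard
  matchable : ∀ e ∈ E(G), ∃ M, G.IsPerfectMatching M ∧ e ∈ M

/-- A matching covered graph is minimal if deleting any edge destroys being matching covered. -/
structure IsMinimalMatchingCovered (G : Graph α β) : Prop where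
  matchingCovered : G.IsMatchingCovered
  not_deleteEdges : ∀ e ∈ E(G), ¬ (G.deleteEdges {e}).IsMatchingCovered

/-- `G` is bipartite with colour classes `A` and `B`. -/
structure IsBipartiteWith (G : Graph α β) (A B : Set α) : Prop where
  disjoint : Disjoint A B
  union_eq : A ∪ B = V(G)
  isLink : ∀ e x y, G.IsLink e x y → (x ∈ A ∧ y ∈ B) ∨ (x ∈ B ∧ y ∈ A)

/-- The set `V₂` of vertices of degree two. -/
def degreeTwoVerts (G : Graph α β) : Set α := {v | v ∈ V(G) ∧ G.degree v = 2}

/-- The class `ℋ₂`: the finite loopless minimal bipartite matching covered graphs with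
`|V₂| = 2 (m - n + 2)`, where `n` is the number of vertices and `m` the number of edges. -/
structure IsTwoVertexExtremal (G : Graph α β) : Prop where
  finite_vertexSet : V(G).Finite
  finite_edgeSet : E(G).Finite
  loopless : G.Loopless
  bipartite : ∃ A B, G.IsBipartiteWith A B
  minimal : G.IsMinimalMatchingCovered
  extremal : (G.degreeTwoVerts.ncard : ℤ) = 2 * ((E(G).ncard : ℤ) - (V(G).ncard : ℤ) + 2)

/-- A `3`-edge: an edge each of whose ends has degree at least three. -/
def IsThreeEdge (G : Graph α β) (e : β) : Prop :=
  e ∈ E(G) ∧ ∀ v, G.Inc e v → 3 ≤ G.degree v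

/-- The cut `∂(W)`: the edges with one end in `W` and one end outside `W`. -/
def cut (G : Graph α β) (W : Set α) : Set β :=
  {e | ∃ x y, G.IsLink e x y ∧ x ∈ W ∧ y ∉ W}

/-- `∂^A(W)`: the edges of `∂(W)` whose end in `W` belongs to `A`. -/
def cutAt (G : Graph α β) (A W : Set α) : Set β :=
  {e | ∃ x y, G.IsLink e x y ∧ x ∈ W ∧ y ∉ W ∧ x ∈ A}

/-- The cut `∂(W)` of a graph with colour classes `A` and `B` is balanced if
`|∂^A(W)| = |∂^B(W)|`. -/
def IsBalancedCut (G : Graph α β) (A B W : Set α) : Prop :=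
  (G.cutAt A W).ncard = (G.cutAt B W).ncard

end Graph

/-! Direct every edge from `A` to `B`, and call a vertex set balanced if it has equally many
vertices of each colour. By Hall's theorem, minimality yields two facts: every proper nonempty
balanced set is entered by an edge, and every edge `e` is the only edge entering some balanced set.
The union `maxSole e` of all such sets is again one.

Uncrossing along perfect matchings shows that these sets are disjoint for distinct edges at a vertex
of `A3` (degree at least three, in `A`) and nested along paths of edges at `A3` (`disjoint_maxSole`,
`maxSole_subset_maxSole`). Hence the edges at `A3` form a forest. Count its components on the whole
vertex set: each degree-two vertex of `A` is a component by itself, and at least two further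
components meet `B`. This gives at least m - n + 2 degree-two vertices in `A`, and likewise in `B`.
Extremality is equality for both colours, so exactly two components meet `B`, and symmetrically for
`A` (`Tight`).

In the tight case, for `a` in `A3`, the sets `maxSole g` over the edges `g` at `a` cover everything
except `a` and one vertex `r` (`exists_mate`). Every edge leaving one of these sets ends at `r`, and
the symmetric argument gives `r` the same degree as `a`, so exactly one edge `f` leaves `maxSole e`.
Thus `W = maxSole e` has cut {e, f}, and a last forest count shows that `f` is a 3-edge. -/

/-! ### A linear-algebra criterion for forests -/

/-- The sets `K e` show that every edge is a bridge. The coboundary map from functions on vertices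
to functions on edges is then onto, its kernel is the functions constant on components, and
rank-nullity gives the count. -/
theorem card_quot_add_card {V ε : Type*} [Finite V] [Finite ε] (s t : ε → V) (K : ε → Set V)
    (ht : ∀ e, t e ∈ K e) (hs : ∀ e, s e ∉ K e)
    (hK : ∀ e h, h ≠ e → (s h ∈ K e ↔ t h ∈ K e)) :
    Nat.card (Quot fun u v => ∃ h, s h = u ∧ t h = v) + Nat.card ε = Nat.card V := by
  classical
  have := Fintype.ofFinite V
  have := Fintype.ofFinite ε
  set r : V → V → Prop := fun u v => ∃ h, s h = u ∧ t h = v with hr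
  have : Fintype (Quot r) := Fintype.ofFinite _
  let δ : (V → ℚ) →ₗ[ℚ] (ε → ℚ) :=
    { toFun := fun x e => x (t e) - x (s e)
      map_add' := by intros; ext; simp; ring
      map_smul' := by intros; ext; simp; ring }
  have hsurj : Function.Surjective δ := by
    intro y
    -- The indicator of `K e` has coboundary 1 at `e` and 0 at every other edge.
    refine ⟨fun v => ∑ e, y e * (if v ∈ K e then 1 else 0), ?_⟩
    ext h
    change (∑ e, y e * (if t h ∈ K e then 1 else 0)) -
      ∑ e, y e * (if s h ∈ K e then 1 else 0) = y h
    rw [← Finset.sum_sub_distrib, Finset.sum_eq_single h]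
    · simp [ht, hs]
    · intro e _ he
      have := hK e h he.symm
      by_cases h1 : t h ∈ K e <;> simp [h1, this]
    · simp
  let q : (Quot r → ℚ) →ₗ[ℚ] (V → ℚ) := LinearMap.funLeft ℚ ℚ (Quot.mk r)
  have hq : Function.Injective q :=
    LinearMap.funLeft_injective_of_surjective _ _ _ Quot.mk_surjective
  have hker : LinearMap.ker δ = LinearMap.range q := by
    ext x
    simp only [LinearMap.mem_ker, LinearMap.mem_range]
    constructor
    · intro hx
      refine ⟨Quot.lift x ?_, rfl⟩
      rintro u v ⟨h, rfl, rfl⟩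
      have : x (t h) - x (s h) = 0 := congrFun hx h
      linarith
    · rintro ⟨y, rfl⟩
      ext h
      change y (Quot.mk r (t h)) - y (Quot.mk r (s h)) = 0
      rw [Quot.sound (r := r) ⟨h, rfl, rfl⟩, sub_self]
  have h1 := LinearMap.finrank_range_add_finrank_ker δ
  rw [hker, LinearMap.finrank_range_of_inj hq, LinearMap.range_eq_top.mpr hsurj, finrank_top] at h1
  simp only [Module.finrank_fintype_fun_eq_card] at h1
  simp only [Nat.card_eq_fintype_card]
  omega

/-! ### Balanced sets and perfect matchings in directed bipartite graphs -/

/-- A bipartite multigraph with colour classes `A` and `Aᶜ`; every edge `e` has its end `s e` in `A`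
and its end `t e` in `Aᶜ`, and is thought of as directed from `s e` to `t e`. -/
structure Bigraph (V ε : Type*) where
  s : ε → V
  t : ε → V
  A : Set V
  s_mem : ∀ e, s e ∈ A
  t_mem : ∀ e, t e ∉ A

namespace Bigraph

variable {V ε : Type*} (D : Bigraph V ε)

/-- The same graph with the two colour classes exchanged. -/
def swap : Bigraph V ε where
  s := D.t
  t := D.s
  A := D.Aᶜ
  s_mem := D.t_mem
  t_mem e h := h (D.s_mem e)

/-- A vertex set meeting both colour classes in equally many vertices. -/
def Balanced (Z : Set V) : Prop := (Z ∩ D.A).ncard = (Z \ D.A).ncard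

/-- A set of edges meeting every vertex exactly once. -/
def IsPM (M : Set ε) : Prop := ∀ v, ∃! e, e ∈ M ∧ (D.s e = v ∨ D.t e = v)

/-- No edge of `M` crosses the boundary of `Z`. -/
def Closed (M : Set ε) (Z : Set V) : Prop := ∀ e ∈ M, D.s e ∈ Z ↔ D.t e ∈ Z

/-- `Z` is balanced and `e` is the only edge directed into `Z`. -/
structure Sole (e : ε) (Z : Set V) : Prop where
  balanced : D.Balanced Z
  s_notMem : D.s e ∉ Z
  t_mem : D.t e ∈ Z
  eq_of_enters : ∀ f, D.s f ∉ Z → D.t f ∈ Z → f = e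

/-- The bipartite form of being minimal matching covered: every edge lies in a perfect matching,
every proper balanced set is entered by an edge, and every edge is the sole edge entering some
balanced set. -/
structure IsMinimal : Prop where
  nonempty : Nonempty ε
  cover : ∀ e, ∃ M, D.IsPM M ∧ e ∈ M
  exists_enters : ∀ Z, D.Balanced Z → Z.Nonempty → Z ≠ Set.univ → ∃ e, D.s e ∉ Z ∧ D.t e ∈ Z
  exists_sole : ∀ e, ∃ Z, D.Sole e Z

variable {D}

theorem IsPM.eq_of_s_eq {M : Set ε} (hM : D.IsPM M) {e f : ε} (he : e ∈ M) (hf : f ∈ M)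
    (h : D.s e = D.s f) : e = f :=
  (hM (D.s f)).unique ⟨he, .inl h⟩ ⟨hf, .inl rfl⟩

theorem IsPM.eq_of_t_eq {M : Set ε} (hM : D.IsPM M) {e f : ε} (he : e ∈ M) (hf : f ∈ M)
    (h : D.t e = D.t f) : e = f :=
  (hM (D.t f)).unique ⟨he, .inr h⟩ ⟨hf, .inr rfl⟩

theorem IsPM.exists_s_eq {M : Set ε} (hM : D.IsPM M) {v : V} (hv : v ∈ D.A) :
    ∃ e ∈ M, D.s e = v := by
  obtain ⟨e, ⟨he, h | h⟩, -⟩ := hM v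
  · exact ⟨e, he, h⟩
  · exact absurd (h ▸ hv) (D.t_mem e)

theorem IsPM.exists_t_eq {M : Set ε} (hM : D.IsPM M) {v : V} (hv : v ∉ D.A) :
    ∃ e ∈ M, D.t e = v := by
  obtain ⟨e, ⟨he, h | h⟩, -⟩ := hM v
  · exact absurd (h ▸ D.s_mem e) hv
  · exact ⟨e, he, h⟩

theorem IsPM.ncard_inter {M : Set ε} (hM : D.IsPM M) (Z : Set V) :
    (Z ∩ D.A).ncard = {e ∈ M | D.s e ∈ Z}.ncard := by
  have : Z ∩ D.A = D.s '' {e ∈ M | D.s e ∈ Z} := by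
    ext v
    constructor
    · rintro ⟨hv, hA⟩
      obtain ⟨e, he, rfl⟩ := hM.exists_s_eq hA
      exact ⟨e, ⟨he, hv⟩, rfl⟩
    · rintro ⟨e, he, rfl⟩
      exact ⟨he.2, D.s_mem e⟩
  rw [this, Set.InjOn.ncard_image]
  exact fun e he f hf h => hM.eq_of_s_eq he.1 hf.1 h

theorem IsPM.ncard_sdiff {M : Set ε} (hM : D.IsPM M) (Z : Set V) :
    (Z \ D.A).ncard = {e ∈ M | D.t e ∈ Z}.ncard := by
  have : Z \ D.A = D.t '' {e ∈ M | D.t e ∈ Z} := by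
    ext v
    constructor
    · rintro ⟨hv, hA⟩
      obtain ⟨e, he, rfl⟩ := hM.exists_t_eq hA
      exact ⟨e, ⟨he, hv⟩, rfl⟩
    · rintro ⟨e, he, rfl⟩
      exact ⟨he.2, D.t_mem e⟩
  rw [this, Set.InjOn.ncard_image]
  exact fun e he f hf h => hM.eq_of_t_eq he.1 hf.1 h

theorem IsPM.balanced {M : Set ε} (hM : D.IsPM M) {Z : Set V} (hZ : D.Closed M Z) :
    D.Balanced Z := by
  rw [Balanced, hM.ncard_inter, hM.ncard_sdiff]
  congr 1
  ext e
  exact and_congr_right (hZ e)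

/-- As many matching edges start in a balanced set as end in it, so if none enters then none leaves.
-/
theorem IsPM.closed [Finite ε] {M : Set ε} (hM : D.IsPM M) {Z : Set V} (hZ : D.Balanced Z)
    (h : ∀ e ∈ M, D.t e ∈ Z → D.s e ∈ Z) : D.Closed M Z := by
  rw [Balanced, hM.ncard_inter, hM.ncard_sdiff] at hZ
  have hsub : {e ∈ M | D.t e ∈ Z} ⊆ {e ∈ M | D.s e ∈ Z} := fun e he => ⟨he.1, h e he.1 he.2⟩
  have := Set.eq_of_subset_of_ncard_le hsub hZ.le (Set.toFinite _)
  exact fun e he => ⟨fun hs => (this.ge ⟨he, hs⟩).2, h e he⟩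

theorem Closed.union {M : Set ε} {Z Z' : Set V} (h : D.Closed M Z) (h' : D.Closed M Z') :
    D.Closed M (Z ∪ Z') := fun e he => or_congr (h e he) (h' e he)

theorem Closed.inter {M : Set ε} {Z Z' : Set V} (h : D.Closed M Z) (h' : D.Closed M Z') :
    D.Closed M (Z ∩ Z') := fun e he => and_congr (h e he) (h' e he)

theorem Sole.closed [Finite ε] {M : Set ε} (hM : D.IsPM M) {e : ε} {Z : Set V} (hZ : D.Sole e Z)
    (he : e ∉ M) : D.Closed M Z :=
  hM.closed hZ.balanced fun f hf hft => by
    by_contra hfs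
    exact he (hZ.eq_of_enters f hfs hft ▸ hf)

theorem Sole.s_mem_of_ne {e f : ε} {Z : Set V} (hZ : D.Sole e Z) (hf : D.t f ∈ Z) (hfe : f ≠ e) :
    D.s f ∈ Z := by
  by_contra h
  exact hfe (hZ.eq_of_enters f h hf)

theorem balanced_swap {Z : Set V} : D.swap.Balanced Z ↔ D.Balanced Z := by
  simp only [Balanced, swap, Set.sdiff_eq, compl_compl]
  exact eq_comm

theorem isPM_swap {M : Set ε} : D.swap.IsPM M ↔ D.IsPM M := by
  simp only [IsPM, swap, or_comm]

theorem IsMinimal.exists_isPM (h : D.IsMinimal) : ∃ M, D.IsPM M :=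
  let ⟨e⟩ := h.nonempty
  let ⟨M, hM, _⟩ := h.cover e
  ⟨M, hM⟩

theorem IsMinimal.balanced_compl [Finite V] (h : D.IsMinimal) {Z : Set V} (hZ : D.Balanced Z) :
    D.Balanced Zᶜ := by
  obtain ⟨M, hM⟩ := h.exists_isPM
  have hu : D.Balanced Set.univ := hM.balanced fun e _ => by simp
  have h1 : (Z ∩ D.A).ncard + (Zᶜ ∩ D.A).ncard = (Set.univ ∩ D.A).ncard := by
    rw [← Set.ncard_union_eq (by
      exact (disjoint_compl_right.mono Set.inter_subset_left Set.inter_subset_left)),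
      ← Set.union_inter_distrib_right, Set.union_compl_self]
  have h2 : (Z \ D.A).ncard + (Zᶜ \ D.A).ncard = (Set.univ \ D.A).ncard := by
    rw [← Set.ncard_union_eq (by
      exact (disjoint_compl_right.mono Set.sdiff_subset Set.sdiff_subset)),
      ← Set.union_sdiff_distrib, Set.union_compl_self]
  simp only [Balanced] at *
  omega

theorem IsMinimal.exists_leaves [Finite V] (h : D.IsMinimal) {Z : Set V} (hZ : D.Balanced Z)
    (hne : Z.Nonempty) (hu : Z ≠ Set.univ) : ∃ e, D.s e ∈ Z ∧ D.t e ∉ Z := by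
  obtain ⟨e, h1, h2⟩ := h.exists_enters Zᶜ (h.balanced_compl hZ)
    (Set.nonempty_compl.mpr hu) (by simpa using hne.ne_empty)
  exact ⟨e, not_not.mp h1, h2⟩

theorem IsMinimal.swap [Finite V] (h : D.IsMinimal) : D.swap.IsMinimal where
  nonempty := h.nonempty
  cover e := by simpa only [isPM_swap] using h.cover e
  exists_enters Z hZ hne hu :=
    let ⟨e, h1, h2⟩ := h.exists_leaves (balanced_swap.mp hZ) hne hu
    ⟨e, h2, h1⟩
  exists_sole e := by
    obtain ⟨Z, hZ⟩ := h.exists_sole e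
    exact ⟨Zᶜ, balanced_swap.mpr (h.balanced_compl hZ.balanced), not_not.mpr hZ.t_mem, hZ.s_notMem,
      fun f h1 h2 => hZ.eq_of_enters f h2 (not_not.mp h1)⟩

theorem Sole.of_swap [Finite V] (h : D.IsMinimal) {e : ε} {W : Set V} (hW : D.swap.Sole e W) :
    D.Sole e Wᶜ :=
  ⟨h.balanced_compl (balanced_swap.mp hW.balanced), not_not.mpr hW.t_mem, hW.s_notMem,
    fun f h1 h2 => hW.eq_of_enters f h2 (not_not.mp h1)⟩

theorem IsMinimal.exists_s_eq (h : D.IsMinimal) {a : V} (ha : a ∈ D.A) : ∃ e, D.s e = a := by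
  obtain ⟨M, hM⟩ := h.exists_isPM
  obtain ⟨e, -, he⟩ := hM.exists_s_eq ha
  exact ⟨e, he⟩

theorem IsMinimal.eq_of_parallel (h : D.IsMinimal) {e f : ε} (hs : D.s e = D.s f)
    (ht : D.t e = D.t f) : e = f := by
  obtain ⟨Z, hZ⟩ := h.exists_sole f
  exact hZ.eq_of_enters e (hs ▸ hZ.s_notMem) (ht ▸ hZ.t_mem)

/-- The two ends of `e` form a proper balanced set, and an edge leaving it must start at `s e`. -/
theorem IsMinimal.exists_ne [Finite V] (h : D.IsMinimal) (e : ε) : ∃ f, f ≠ e ∧ D.s f = D.s e := by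
  obtain ⟨M, hM, heM⟩ := h.cover e
  have hb : D.Balanced {D.s e, D.t e} := by
    refine hM.balanced fun f hf => ?_
    have h1 : D.s f ∈ ({D.s e, D.t e} : Set V) ↔ f = e := by
      constructor
      · rintro (h1 | h1)
        · exact hM.eq_of_s_eq hf heM h1
        · exact absurd (h1 ▸ D.s_mem f : D.t e ∈ D.A) (D.t_mem e)
      · rintro rfl; simp
    have h2 : D.t f ∈ ({D.s e, D.t e} : Set V) ↔ f = e := by
      constructor
      · rintro (h1 | h1)
        · exact absurd (h1 ▸ D.s_mem e : D.t f ∈ D.A) (D.t_mem f)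
        · exact hM.eq_of_t_eq hf heM h1
      · rintro rfl; simp
    rw [h1, h2]
  have hu : ({D.s e, D.t e} : Set V) ≠ Set.univ := by
    intro hu
    obtain ⟨Z, hZ⟩ := h.exists_sole e
    have hZA : Z ∩ D.A = ∅ := by
      ext v
      simp only [Set.mem_inter_iff, Set.mem_empty_iff_false, iff_false, not_and]
      intro hv hA
      have : v ∈ ({D.s e, D.t e} : Set V) := hu ▸ Set.mem_univ v
      rcases this with rfl | rfl
      · exact hZ.s_notMem hv
      · exact D.t_mem e hA
    have := hZ.balanced
    rw [Balanced, hZA, Set.ncard_empty, eq_comm, Set.ncard_eq_zero] at this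
    exact this.le ⟨hZ.t_mem, D.t_mem e⟩
  obtain ⟨f, h1, h2⟩ := h.exists_leaves hb ⟨_, .inl rfl⟩ hu
  refine ⟨f, ?_, ?_⟩
  · rintro rfl; simp at h2
  · rcases h1 with h1 | h1
    · exact h1
    · exact absurd (h1 ▸ D.s_mem f : D.t e ∈ D.A) (D.t_mem e)

theorem IsMinimal.exists_isPM_notMem [Finite V] (h : D.IsMinimal) (e : ε) :
    ∃ M, D.IsPM M ∧ e ∉ M := by
  obtain ⟨f, hfe, hs⟩ := h.exists_ne e
  obtain ⟨M, hM, hf⟩ := h.cover f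
  exact ⟨M, hM, fun he => hfe (hM.eq_of_s_eq hf he hs)⟩

/-! ### Uncrossing the sets entered by a single edge -/

variable (D)

/-- The largest balanced set whose sole entering edge is `e`. -/
def maxSole (e : ε) : Set V := ⋃₀ {Z | D.Sole e Z}

/-- The vertices of `A` of degree at least three. -/
def A3 : Set V := {v ∈ D.A | 3 ≤ {e | D.s e = v}.ncard}

variable {D}

theorem Sole.subset_maxSole {e : ε} {Z : Set V} (hZ : D.Sole e Z) : Z ⊆ D.maxSole e :=
  Set.subset_sUnion_of_mem hZ

/-- A single perfect matching avoiding `e` crosses the boundary of none of the sets in the union, so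
it does not cross that of the union, which is therefore balanced. -/
theorem IsMinimal.sole_maxSole [Finite V] [Finite ε] (h : D.IsMinimal) (e : ε) :
    D.Sole e (D.maxSole e) := by
  obtain ⟨M, hM, he⟩ := h.exists_isPM_notMem e
  refine ⟨hM.balanced fun f hf => ?_, ?_, ?_, ?_⟩
  · simp only [maxSole, Set.mem_sUnion, Set.mem_ofPred_eq]
    exact exists_congr fun Z => and_congr_right fun hZ => hZ.closed hM he f hf
  · rintro ⟨Z, hZ, h1⟩
    exact Sole.s_notMem hZ h1
  · obtain ⟨Z, hZ⟩ := h.exists_sole e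
    exact ⟨Z, hZ, hZ.t_mem⟩
  · rintro f hs ⟨Z, hZ, h1⟩
    exact Sole.eq_of_enters hZ f (fun h2 => hs ⟨Z, hZ, h2⟩) h1

theorem exists_third [Finite ε] {e f : ε} (he : D.s e ∈ D.A3) :
    ∃ g, D.s g = D.s e ∧ g ≠ e ∧ g ≠ f := by
  by_contra! hcon
  have hsub : {g | D.s g = D.s e} ⊆ {e, f} := fun g hg => by
    by_cases hge : g = e
    · exact .inl hge
    · exact .inr (hcon g hg hge)
  have h1 := Set.ncard_le_ncard hsub (Set.toFinite _)
  have h2 := (Set.ncard_insert_le e {f}).trans_eq (by rw [Set.ncard_singleton])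
  have h3 := he.2
  omega

/-- Degree three supplies a third edge at the common end; a perfect matching through it avoids both
`e` and `f`, so `Z ∩ Z'` is balanced. If nonempty it would be entered by an edge, but such an edge
must enter `Z` or `Z'`, hence be `e` or `f`, and neither can enter both. -/
theorem IsMinimal.disjoint_of_sole [Finite V] [Finite ε] (h : D.IsMinimal) {e f : ε} {Z Z' : Set V}
    (hZ : D.Sole e Z) (hZ' : D.Sole f Z') (he : D.s e ∈ D.A3) (hs : D.s e = D.s f) (hne : e ≠ f) :
    Disjoint Z Z' := by
  obtain ⟨g, hg, hge, hgf⟩ := exists_third (f := f) he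
  obtain ⟨M, hM, hgM⟩ := h.cover g
  have heM : e ∉ M := fun h' => hge (hM.eq_of_s_eq hgM h' hg)
  have hfM : f ∉ M := fun h' => hgf (hM.eq_of_s_eq hgM h' (hg.trans hs))
  rw [Set.disjoint_iff_inter_eq_empty]
  by_contra hcon
  obtain ⟨k, h1, h2⟩ := h.exists_enters _
    (hM.balanced ((hZ.closed hM heM).inter (hZ'.closed hM hfM)))
    (Set.nonempty_iff_ne_empty.mpr hcon)
    (fun hu => hZ.s_notMem (hu.ge (Set.mem_univ _)).1)
  have hkZ : D.s k ∈ Z := by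
    by_contra hk
    obtain rfl := hZ.eq_of_enters k hk h2.1
    exact hne (hZ'.eq_of_enters k (hs ▸ hZ'.s_notMem) h2.2)
  have hkZ' : D.s k ∉ Z' := fun h3 => h1 ⟨hkZ, h3⟩
  obtain rfl := hZ'.eq_of_enters k hkZ' h2.2
  exact hZ.s_notMem (hs ▸ hkZ)

theorem IsMinimal.disjoint_maxSole [Finite V] [Finite ε] (h : D.IsMinimal) {e f : ε}
    (he : D.s e ∈ D.A3) (hs : D.s e = D.s f) (hne : e ≠ f) :
    Disjoint (D.maxSole e) (D.maxSole f) :=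
  h.disjoint_of_sole (h.sole_maxSole e) (h.sole_maxSole f) he hs hne

/-- A perfect matching through the middle edge `f` avoids `e` and `g`, so the union of the two sets
is balanced. Since `s g` lies in `maxSole e`, only `e` enters the union, and maximality absorbs it.
-/
theorem IsMinimal.maxSole_subset_maxSole [Finite V] [Finite ε] (h : D.IsMinimal) {e f g : ε}
    (hef : D.t f = D.t e) (hfg : D.s f = D.s g) (hfe : f ≠ e) (hne : f ≠ g) (hg : D.s g ∈ D.A3) :
    D.maxSole g ⊆ D.maxSole e := by
  obtain ⟨M, hM, hfM⟩ := h.cover f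
  have heM : e ∉ M := fun h' => hfe (hM.eq_of_t_eq hfM h' hef)
  have hgM : g ∉ M := fun h' => hne (hM.eq_of_s_eq hfM h' hfg)
  have hZe := h.sole_maxSole e
  have hZf := h.sole_maxSole f
  have hZg := h.sole_maxSole g
  have h1 : D.s g ∈ D.maxSole e := hfg ▸ hZe.s_mem_of_ne (hef ▸ hZe.t_mem) hfe
  have h2 : D.s e ∉ D.maxSole g := fun h' =>
    Set.disjoint_left.mp (h.disjoint_maxSole (hfg ▸ hg) hfg hne)
      (hZf.s_mem_of_ne (hef ▸ hZf.t_mem) hfe.symm) h'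
  refine Set.subset_union_right.trans (Sole.subset_maxSole (Z := D.maxSole e ∪ D.maxSole g)
    ⟨hM.balanced ((hZe.closed hM heM).union (hZg.closed hM hgM)), ?_, .inl hZe.t_mem, ?_⟩)
  · rintro (h' | h')
    · exact hZe.s_notMem h'
    · exact h2 h'
  · intro k hs ht
    rw [Set.mem_union, not_or] at hs
    rcases ht with ht | ht
    · exact hZe.eq_of_enters k hs.1 ht
    · obtain rfl := hZg.eq_of_enters k hs.2 ht
      exact absurd h1 hs.1

end Bigraph

/-! ### The forest of edges at `A3` and its components -/

namespace Bigraph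
variable {V ε : Type*} (D : Bigraph V ε)

/-- One step along a path of edges leaving `A3`: from `e` through a second edge `f` at `t e` to a
further edge `g` at `s f`. -/
def Step (e g : ε) : Prop :=
  ∃ f, D.t f = D.t e ∧ f ≠ e ∧ D.s f = D.s g ∧ f ≠ g ∧ D.s g ∈ D.A3

/-- The component containing `t e` of the graph formed by the edges at `A3` other than `e`. -/
def branch (e : ε) : Set V :=
  {v | ∃ g, Relation.ReflTransGen D.Step e g ∧
    (v = D.t g ∨ ∃ f, D.t f = D.t g ∧ f ≠ g ∧ D.s f ∈ D.A3 ∧ v = D.s f)}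

/-- Two vertices have the same class when they are joined by a path of edges at `A3`. -/
def Class : Type _ := Quot fun u v : V => ∃ h : {e // D.s e ∈ D.A3}, D.s h = u ∧ D.t h = v

/-- The class of a vertex. -/
def cls (v : V) : D.Class := Quot.mk _ v

variable {D}

instance [Finite V] : Finite D.Class := inferInstanceAs (Finite (Quot _))

theorem cls_s {h : ε} (hh : D.s h ∈ D.A3) : D.cls (D.s h) = D.cls (D.t h) :=
  Quot.sound ⟨⟨h, hh⟩, rfl, rfl⟩

/-- Paths are never handled explicitly: to locate a vertex of a given class, one exhibits a set `U`
that no edge at `A3` crosses. -/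
theorem mem_iff_of_cls_eq {U : Set V} (hU : ∀ h, D.s h ∈ D.A3 → (D.s h ∈ U ↔ D.t h ∈ U)) {u v : V}
    (huv : D.cls u = D.cls v) : u ∈ U ↔ v ∈ U := by
  refine (congrArg (Quot.lift (· ∈ U) ?_) huv).to_iff
  rintro _ _ ⟨h, rfl, rfl⟩
  exact propext (hU h h.2)

theorem s_ne_t (e f : ε) : D.s e ≠ D.t f := fun h => D.t_mem f (h ▸ D.s_mem e)

theorem t_mem_branch (e : ε) : D.t e ∈ D.branch e := ⟨e, .refl, .inl rfl⟩

theorem mem_branch_iff {e h : ε} (hne : h ≠ e) (hh : D.s h ∈ D.A3) :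
    D.s h ∈ D.branch e ↔ D.t h ∈ D.branch e := by
  constructor
  · rintro ⟨g, hg, h1 | ⟨f, hf, hfg, hf3, h1⟩⟩
    · exact absurd h1 (s_ne_t _ _)
    · by_cases hfh : f = h
      · exact ⟨g, hg, .inl (hfh ▸ hf)⟩
      · exact ⟨h, hg.tail ⟨f, hf, hfg, h1.symm, hfh, hh⟩, .inl rfl⟩
  · rintro ⟨g, hg, h1 | ⟨f, hf, hfg, hf3, h1⟩⟩
    · by_cases hgh : h = g
      · subst hgh
        rcases hg.cases_tail with rfl | ⟨g', hg', f, h2, h3, h4, h5, h6⟩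
        · exact absurd rfl hne
        · exact ⟨g', hg', .inr ⟨f, h2, h3, h4 ▸ h6, h4.symm⟩⟩
      · exact ⟨g, hg, .inr ⟨h, h1, hgh, hh, rfl⟩⟩
    · exact absurd h1.symm (s_ne_t _ _)

theorem ncard_edges_eq_sum [Finite ε] (X : Finset V) :
    {e | D.s e ∈ X}.ncard = ∑ a ∈ X, {e | D.s e = a}.ncard := by
  classical
  have := Fintype.ofFinite ε
  have := Finset.card_eq_sum_card_fiberwise (f := D.s) (s := {e | D.s e ∈ X}) (t := X)
    (fun e he => by simpa using he)
  rw [Set.ncard_eq_toFinset_card', Set.toFinset_ofPred, this]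
  refine Finset.sum_congr rfl fun a ha => ?_
  rw [Set.ncard_eq_toFinset_card', Set.toFinset_ofPred, Finset.filter_filter]
  congr 1
  ext e
  simp only [Finset.mem_filter, Finset.mem_univ, true_and]
  exact ⟨fun h => h.2, fun h => ⟨h ▸ ha, h⟩⟩

theorem Balanced.union [Finite V] {Z Z' : Set V} (hZ : D.Balanced Z) (hZ' : D.Balanced Z')
    (hd : Disjoint Z Z') : D.Balanced (Z ∪ Z') := by
  rw [Balanced, Set.union_inter_distrib_right, Set.union_sdiff_distrib,
    Set.ncard_union_eq (hd.mono Set.inter_subset_left Set.inter_subset_left),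
    Set.ncard_union_eq (hd.mono Set.sdiff_subset Set.sdiff_subset), hZ, hZ']

theorem eq_of_cls_eq {v w : V} (hv : v ∈ D.A \ D.A3) (h : D.cls v = D.cls w) : w = v :=
  (mem_iff_of_cls_eq (U := {v}) (fun k hk => by
    have h1 : D.s k ≠ v := fun h' => hv.2 (h' ▸ hk)
    have h2 : D.t k ≠ v := fun h' => D.t_mem k (h' ▸ hv.1)
    simp [h1, h2]) h).mp rfl

theorem eq_or_mem_branch_of_cls_eq {a y : V} (hay : D.cls a = D.cls y) :
    y = a ∨ a ∉ D.A3 ∨ ∃ g, D.s g = a ∧ y ∈ D.branch g := by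
  by_cases ha : a ∈ D.A3
  swap
  · exact .inr (.inl ha)
  have : y ∈ {v | v = a ∨ ∃ g, D.s g = a ∧ v ∈ D.branch g} := by
    refine (mem_iff_of_cls_eq (fun k hk => ?_) hay).mp (.inl rfl)
    constructor
    · rintro (h1 | ⟨g, rfl, hg⟩)
      · exact .inr ⟨k, h1, t_mem_branch k⟩
      · by_cases hkg : k = g
        · subst hkg
          exact .inr ⟨k, rfl, t_mem_branch k⟩
        · exact .inr ⟨g, rfl, (mem_branch_iff hkg hk).mp hg⟩
    · rintro (h1 | ⟨g, rfl, hg⟩)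
      · exact absurd (h1 ▸ ha.1) (D.t_mem k)
      · by_cases hkg : k = g
        · subst hkg
          exact .inl rfl
        · exact .inr ⟨g, rfl, (mem_branch_iff hkg hk).mpr hg⟩
  exact this.imp_right .inr

/-- A path from `b` to `y` runs through a first edge `e` to a vertex of `A3`, and leaves that vertex
by another edge `g`. -/
theorem exists_branch_of_cls_eq {b y : V} (hb : b ∉ D.A) (hy : y ∉ D.A) (hne : y ≠ b)
    (hby : D.cls b = D.cls y) :
    ∃ e g, D.t e = b ∧ D.s e ∈ D.A3 ∧ D.s g = D.s e ∧ e ≠ g ∧ y ∈ D.branch g := by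
  have : y ∈ {v | v = b ∨ ∃ e, D.t e = b ∧ D.s e ∈ D.A3 ∧
      (v = D.s e ∨ ∃ g, D.s g = D.s e ∧ e ≠ g ∧ v ∈ D.branch g)} := by
    refine (mem_iff_of_cls_eq (fun k hk => ?_) hby).mp (.inl rfl)
    constructor
    · rintro (h1 | ⟨e, he, he3, h1 | ⟨g, hg, hge, h1⟩⟩)
      · exact absurd (h1 ▸ D.s_mem k) hb
      · by_cases hke : e = k
        · exact .inl (hke ▸ he)
        · exact .inr ⟨e, he, he3, .inr ⟨k, h1, hke, t_mem_branch k⟩⟩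
      · refine .inr ⟨e, he, he3, .inr ⟨g, hg, hge, ?_⟩⟩
        by_cases hkg : k = g
        · exact hkg ▸ t_mem_branch k
        · exact (mem_branch_iff hkg hk).mp h1
    · rintro (h1 | ⟨e, he, he3, h1 | ⟨g, hg, hge, h1⟩⟩)
      · exact .inr ⟨k, h1, hk, .inl rfl⟩
      · exact absurd h1.symm (s_ne_t _ _)
      · by_cases hkg : k = g
        · subst hkg
          exact .inr ⟨e, he, he3, .inl hg⟩
        · exact .inr ⟨e, he, he3, .inr ⟨g, hg, hge, (mem_branch_iff hkg hk).mpr h1⟩⟩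
  rcases this with rfl | ⟨e, he, he3, rfl | ⟨g, hg, hge, h1⟩⟩
  · exact absurd rfl hne
  · exact absurd (D.s_mem e) hy
  · exact ⟨e, g, he, he3, hg, hge, h1⟩

/-- A vertex of `A` outside `A3` meets no forest edge, so it is a class by itself, distinct from the
classes of vertices outside `A`. -/
theorem add_le_card_class [Finite V] {k : ℕ} (g : Fin k → V) (hg : ∀ i, g i ∉ D.A)
    (hinj : Function.Injective fun i => D.cls (g i)) :
    (D.A \ D.A3).ncard + k ≤ Nat.card D.Class := by
  have hi : Function.Injective
      (Sum.elim (fun v : ↥(D.A \ D.A3) => D.cls v) fun i => D.cls (g i)) := by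
    refine Function.Injective.sumElim ?_ hinj ?_
    · intro v w hvw
      exact Subtype.ext (eq_of_cls_eq v.2 hvw).symm
    · intro v i hvi
      exact hg i (eq_of_cls_eq v.2 hvi ▸ v.2.1)
  have := Nat.card_le_card_of_injective _ hi
  rwa [Nat.card_sum, Nat.card_coe_set_eq, Nat.card_fin] at this

theorem cls_eq_or [Finite V] (hD : Nat.card D.Class = (D.A \ D.A3).ncard + 2) {x y z : V} (hx : x ∉ D.A)
    (hy : y ∉ D.A) (hz : z ∉ D.A) (hxy : D.cls x ≠ D.cls y) (hxz : D.cls x ≠ D.cls z) :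
    D.cls y = D.cls z := by
  by_contra hyz
  have := add_le_card_class (D := D) ![x, y, z] (fun i => by fin_cases i <;> simpa)
    (fun i j hij => by fin_cases i <;> fin_cases j <;> simp_all)
  omega

section Finite

variable [Finite V] [Finite ε]

/-- Nesting of the maximal sets is iterated along the steps of a path. As `s e` lies outside
`maxSole e`, this makes `e` a bridge when `s e` is in `A3`. -/
theorem IsMinimal.branch_subset (h : D.IsMinimal) (e : ε) : D.branch e ⊆ D.maxSole e := by
  rintro v ⟨g, hg, hv⟩
  have hsub : D.maxSole g ⊆ D.maxSole e := by
    clear hv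
    induction hg with
    | refl => exact subset_rfl
    | tail _ hstep ih =>
      obtain ⟨f, h1, h2, h3, h4, h5⟩ := hstep
      exact (h.maxSole_subset_maxSole h1 h3 h2 h4 h5).trans ih
  refine hsub ?_
  have hg' := h.sole_maxSole g
  rcases hv with rfl | ⟨f, hf, hfg, -, rfl⟩
  · exact hg'.t_mem
  · exact hg'.s_mem_of_ne (hf ▸ hg'.t_mem) hfg

theorem IsMinimal.s_notMem_branch (h : D.IsMinimal) (e : ε) : D.s e ∉ D.branch e :=
  fun h' => (h.sole_maxSole e).s_notMem (h.branch_subset e h')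

theorem IsMinimal.card_class_add (h : D.IsMinimal) :
    Nat.card D.Class + {e | D.s e ∈ D.A3}.ncard = Nat.card V :=
  card_quot_add_card (ε := {e // D.s e ∈ D.A3}) (fun e => D.s e) (fun e => D.t e)
    (fun e => D.branch e) (fun _ => t_mem_branch _) (fun _ => h.s_notMem_branch _)
    (fun _ k hne => mem_branch_iff (fun h' => hne (Subtype.ext h')) k.2)

/-- The edges at a set of vertices of `A3` form a forest. -/
theorem IsMinimal.ncard_edges_lt (h : D.IsMinimal) {X Y : Set V} (hX : X ⊆ D.A3) (hne : X.Nonempty)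
    (hXY : ∀ e, D.s e ∈ X → D.t e ∈ Y) : {e | D.s e ∈ X}.ncard < X.ncard + Y.ncard := by
  have key := card_quot_add_card (V := ↥(X ∪ Y)) (ε := {e // D.s e ∈ X})
    (fun e => ⟨D.s e, .inl e.2⟩) (fun e => ⟨D.t e, .inr (hXY e e.2)⟩)
    (fun e => {v | (v : V) ∈ D.branch e}) (fun e => t_mem_branch _) (fun e => h.s_notMem_branch _)
    (fun e k hne => mem_branch_iff (fun h' => hne (Subtype.ext h')) (hX k.2))
  obtain ⟨x, hx⟩ := hne
  have : Nonempty (Quot fun u v : ↥(X ∪ Y) => ∃ k : {e // D.s e ∈ X},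
      (⟨D.s k, .inl k.2⟩ : ↥(X ∪ Y)) = u ∧ ⟨D.t k, .inr (hXY k k.2)⟩ = v) :=
    ⟨Quot.mk _ ⟨x, .inl hx⟩⟩
  have h1 := Nat.card_pos (α := Quot fun u v : ↥(X ∪ Y) => ∃ k : {e // D.s e ∈ X},
      (⟨D.s k, .inl k.2⟩ : ↥(X ∪ Y)) = u ∧ ⟨D.t k, .inr (hXY k k.2)⟩ = v)
  have h2 : Nat.card ↥(X ∪ Y) ≤ X.ncard + Y.ncard := Set.ncard_union_le X Y
  have h3 : Nat.card {e // D.s e ∈ X} = {e | D.s e ∈ X}.ncard := rfl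
  omega

/-- A nonempty `X` would carry at least 3|X| edges, while a forest on `X ∪ Y` has fewer than |X| +
|Y| ≤ 2|X| + 1. -/
theorem IsMinimal.eq_empty_of_edges (h : D.IsMinimal) {X Y : Set V} (hX : X ⊆ D.A3)
    (hXY : ∀ e, D.s e ∈ X → D.t e ∈ Y) (hY : Y.ncard ≤ X.ncard + 1) : X = ∅ := by
  by_contra hne
  have h1 := h.ncard_edges_lt hX (Set.nonempty_iff_ne_empty.mpr hne) hXY
  obtain ⟨X, rfl⟩ := (Set.toFinite X).exists_finset_coe
  have h2 : ∑ a ∈ X, 3 ≤ ∑ a ∈ X, {e | D.s e = a}.ncard :=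
    Finset.sum_le_sum fun a ha => (hX ha).2
  rw [← ncard_edges_eq_sum, Finset.sum_const, smul_eq_mul] at h2
  simp only [Finset.mem_coe, Set.ncard_coe_finset] at h1 hY
  have : X.card ≠ 0 := fun h0 => hne (by simpa using h0)
  omega

theorem IsMinimal.two_le_degree (h : D.IsMinimal) {a : V} (ha : a ∈ D.A) : 2 ≤ {e | D.s e = a}.ncard := by
  obtain ⟨e, rfl⟩ := h.exists_s_eq ha
  obtain ⟨f, hne, hf⟩ := h.exists_ne e
  rw [← Set.ncard_pair hne]
  exact Set.ncard_le_ncard (by rintro x (rfl | rfl) <;> simp [hf]) (Set.toFinite _)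

theorem IsMinimal.card_edges (h : D.IsMinimal) :
    Nat.card ε = 2 * (D.A \ D.A3).ncard + {e | D.s e ∈ D.A3}.ncard := by
  have h1 : {e | D.s e ∈ D.A \ D.A3}.ncard = 2 * (D.A \ D.A3).ncard := by
    obtain ⟨X, hX⟩ := (Set.toFinite (D.A \ D.A3)).exists_finset_coe
    rw [← hX]
    simp only [Finset.mem_coe, Set.ncard_coe_finset, ncard_edges_eq_sum]
    rw [Finset.sum_congr rfl (g := fun _ => 2), Finset.sum_const, smul_eq_mul, mul_comm]
    intro a ha
    have ha : a ∈ D.A \ D.A3 := hX ▸ ha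
    have h2 := h.two_le_degree ha.1
    have h3 : ¬ 3 ≤ {e | D.s e = a}.ncard := fun h' => ha.2 ⟨ha.1, h'⟩
    omega
  rw [← h1, ← Set.ncard_univ, ← Set.ncard_union_eq]
  · congr 1
    ext e
    simp [D.s_mem e, em']
  · exact Set.disjoint_left.mpr fun e he => he.2

/-- The two neighbours of a vertex of degree two in `A` lie in different classes. -/
theorem IsMinimal.cls_ne (h : D.IsMinimal) {e f : ε} (hs : D.s e = D.s f) (hne : e ≠ f)
    (he : D.s e ∉ D.A3) : D.cls (D.t e) ≠ D.cls (D.t f) := by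
  intro hcls
  have ht : D.t f ≠ D.t e := fun h' => hne (h.eq_of_parallel hs h'.symm)
  obtain ⟨k, g, hk, hk3, hg, hkg, h1⟩ := exists_branch_of_cls_eq (D.t_mem e) (D.t_mem f) ht hcls
  have hZk := h.sole_maxSole k
  have hZg := h.sole_maxSole g
  -- Were the neighbours in one class, the degree-two vertex `s e` would lie in both of the disjoint
  -- sets `maxSole k` and `maxSole g`, because each contains one of its neighbours.
  refine (h.disjoint_maxSole hk3 hg.symm hkg).notMem_of_mem_left (a := D.s e)
    (hZk.s_mem_of_ne (hk ▸ hZk.t_mem) ?_) (hs ▸ hZg.s_mem_of_ne (h.branch_subset g h1) ?_)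
  · rintro rfl; exact he hk3
  · rintro rfl; exact he (hs ▸ hg ▸ hk3)

/-- The union of the sets `maxSole g` over the edges `g` at a vertex. -/
def fan (D : Bigraph V ε) (a : V) : Set V := {v | ∃ g, D.s g = a ∧ v ∈ D.maxSole g}

theorem IsMinimal.balanced_fan (h : D.IsMinimal) {a : V} (ha : a ∈ D.A3) : D.Balanced (D.fan a) := by
  classical
  obtain ⟨X, hX⟩ := (Set.toFinite {g | D.s g = a}).exists_finset_coe
  have hfan : D.fan a = ⋃ g ∈ X, D.maxSole g := by
    ext v
    have : ∀ g, D.s g = a ↔ g ∈ X := fun g => by rw [← Finset.mem_coe, hX]; rfl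
    simp [fan, this]
  have key : ∀ Y : Finset ε, Y ⊆ X → D.Balanced (⋃ g ∈ Y, D.maxSole g) := by
    intro Y
    induction Y using Finset.induction_on with
    | empty => intro _; simp [Balanced]
    | insert g Y hg ih =>
      intro hY
      rw [Finset.set_biUnion_insert]
      have hgX : ∀ k ∈ insert g Y, D.s k = a := fun k hk => by
        have : k ∈ (X : Set ε) := hY hk
        rwa [hX] at this
      refine (h.sole_maxSole g).balanced.union
        (ih ((Finset.subset_insert _ _).trans hY)) ?_
      rw [Set.disjoint_iUnion₂_right]
      intro k hk
      have h1 := hgX g (Finset.mem_insert_self _ _)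
      refine h.disjoint_maxSole (h1 ▸ ha) (h1.trans (hgX k (Finset.mem_insert_of_mem hk)).symm) ?_
      rintro rfl
      exact hg hk
  exact hfan ▸ key X subset_rfl

theorem IsMinimal.notMem_fan (h : D.IsMinimal) (a : V) : a ∉ D.fan a := by
  rintro ⟨g, rfl, hg⟩
  exact (h.sole_maxSole g).s_notMem hg

theorem IsMinimal.cls_ne_of_notMem_fan (h : D.IsMinimal) {a y : V} (ha : a ∈ D.A3) (hya : y ∉ D.A)
    (hy : y ∉ D.fan a) : D.cls a ≠ D.cls y := by
  intro hcls
  rcases eq_or_mem_branch_of_cls_eq hcls with rfl | h1 | ⟨g, hg, h1⟩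
  · exact hya ha.1
  · exact h1 ha
  · exact hy ⟨g, hg, h.branch_subset g h1⟩

/-- The complement of the fan is balanced and contains `a`, so it also contains a vertex of the
other colour. -/
theorem IsMinimal.exists_notMem_fan (h : D.IsMinimal) {a : V} (ha : a ∈ D.A3) :
    ∃ b, b ∉ D.A ∧ b ∉ D.fan a := by
  have hb := h.balanced_compl (h.balanced_fan ha)
  have : ((D.fan a)ᶜ ∩ D.A).ncard ≠ 0 :=
    Set.ncard_ne_zero_of_mem (a := a) ⟨h.notMem_fan a, ha.1⟩
  rw [hb] at this
  obtain ⟨b, hb1, hb2⟩ := Set.nonempty_of_ncard_ne_zero this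
  exact ⟨b, hb2, hb1⟩

theorem IsMinimal.exists_cls_ne (h : D.IsMinimal) :
    ∃ b b', b ∉ D.A ∧ b' ∉ D.A ∧ D.cls b ≠ D.cls b' := by
  obtain ⟨e⟩ := h.nonempty
  by_cases ha : D.s e ∈ D.A3
  · obtain ⟨b, hb, hbf⟩ := h.exists_notMem_fan ha
    exact ⟨D.t e, b, D.t_mem e, hb, cls_s ha ▸ h.cls_ne_of_notMem_fan ha hb hbf⟩
  · obtain ⟨f, hne, hf⟩ := h.exists_ne e
    exact ⟨D.t e, D.t f, D.t_mem e, D.t_mem f, h.cls_ne hf.symm hne.symm ha⟩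

theorem IsMinimal.card_edges_add (h : D.IsMinimal) :
    Nat.card ε + Nat.card D.Class = 2 * (D.A \ D.A3).ncard + Nat.card V := by
  have h1 := h.card_edges
  have h2 := h.card_class_add
  omega

/-- Together with `card_edges_add` this bounds the number of degree-two vertices in `A` from below
by m - n + 2. -/
theorem IsMinimal.add_two_le (h : D.IsMinimal) : (D.A \ D.A3).ncard + 2 ≤ Nat.card D.Class := by
  obtain ⟨b, b', hb, hb', hne⟩ := h.exists_cls_ne
  refine add_le_card_class ![b, b'] (fun i => ?_) (fun i j hij => ?_)
  · fin_cases i <;> simpa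
  · fin_cases i <;> fin_cases j <;> simp_all

end Finite

end Bigraph

/-! ### The tight case: mates and the two-edge cut -/

namespace Bigraph
variable {V ε : Type*} (D : Bigraph V ε)

/-- The vertices of degree at least three in `A`, and the edges at them, form a forest with only
two components meeting the other colour class. -/
def Tight : Prop := Nat.card D.Class = (D.A \ D.A3).ncard + 2

/-- `r` is the only vertex outside `A` that does not lie in the fan of `a`, and `a` is the only
such vertex in `A`. -/
structure Mate (a r : V) : Prop where
  notMem : r ∉ D.A
  notMem_fan : r ∉ D.fan a
  eq_or : ∀ v, v = a ∨ v = r ∨ v ∈ D.fan a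

variable {D} [Finite V] [Finite ε]

theorem IsMinimal.t_notMem_fan (h : D.IsMinimal) {a : V} {k : ε} (hk : D.s k ∉ D.fan a)
    (hka : D.s k ≠ a) : D.t k ∉ D.fan a := by
  rintro ⟨g, rfl, hg⟩
  exact hka (congrArg D.s ((h.sole_maxSole g).eq_of_enters k (fun h' => hk ⟨g, rfl, h'⟩) hg))

/-- Let X be the vertices of `A` other than `a` outside the fan; all their neighbours are outside
the fan too, hence not in the class of `a`. With only two classes available, a degree-two vertex in
X would have both neighbours in one class, which `cls_ne` forbids. So X lies in `A3`, and the forest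
count `eq_empty_of_edges` empties it. -/
theorem IsMinimal.exists_mate (h : D.IsMinimal) (hD : D.Tight) {a : V} (ha : a ∈ D.A3) :
    ∃ r, D.Mate a r := by
  have hb : ((D.fan a)ᶜ ∩ D.A).ncard = ((D.fan a)ᶜ \ D.A).ncard :=
    h.balanced_compl (h.balanced_fan ha)
  have haR : a ∈ (D.fan a)ᶜ ∩ D.A := ⟨h.notMem_fan a, ha.1⟩
  have hcard : (((D.fan a)ᶜ ∩ D.A) \ {a}).ncard + 1 = ((D.fan a)ᶜ ∩ D.A).ncard :=
    Set.ncard_sdiff_singleton_add_one haR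
  have hto : ∀ k, D.s k ∈ ((D.fan a)ᶜ ∩ D.A) \ {a} → D.t k ∈ (D.fan a)ᶜ \ D.A :=
    fun k hk => ⟨h.t_notMem_fan hk.1.1 hk.2, D.t_mem k⟩
  have hX3 : ((D.fan a)ᶜ ∩ D.A) \ {a} ⊆ D.A3 := by
    intro x hx
    by_contra hx3
    obtain ⟨e, rfl⟩ := h.exists_s_eq hx.1.2
    obtain ⟨f, hne, hf⟩ := h.exists_ne e
    obtain ⟨g, hg⟩ := h.exists_s_eq ha.1
    have he := hto e hx
    have hf' := hto f (hf ▸ hx)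
    have hga : D.cls (D.t g) = D.cls a := by
      rw [← hg, cls_s (hg ▸ ha)]
    exact h.cls_ne hf.symm hne.symm hx3 (cls_eq_or hD (D.t_mem g) he.2 hf'.2
      (hga ▸ h.cls_ne_of_notMem_fan ha he.2 he.1) (hga ▸ h.cls_ne_of_notMem_fan ha hf'.2 hf'.1))
  have hX := h.eq_empty_of_edges hX3 hto (by omega)
  rw [hX, Set.ncard_empty] at hcard
  obtain ⟨r, hr⟩ := Set.ncard_eq_one.mp (hb.symm.trans hcard.symm)
  have hrm : r ∈ (D.fan a)ᶜ \ D.A := hr ▸ rfl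
  refine ⟨r, hrm.2, hrm.1, fun v => ?_⟩
  by_cases hv : v ∈ D.fan a
  · exact .inr (.inr hv)
  by_cases hvA : v ∈ D.A
  · refine .inl ?_
    by_contra hva
    exact hX.le ⟨⟨hv, hvA⟩, hva⟩
  · exact .inr (.inl (hr.le ⟨hv, hvA⟩))

/-- Otherwise the edge would enter `maxSole g` for another edge `g` at `a`, so it would be `g`,
which starts at `a` and not in `maxSole e`. -/
theorem IsMinimal.t_eq_of_leaves (h : D.IsMinimal) {a r : V} (ha : a ∈ D.A3) (hr : D.Mate a r)
    {e k : ε} (he : D.s e = a) (hs : D.s k ∈ D.maxSole e) (ht : D.t k ∉ D.maxSole e) :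
    D.t k = r := by
  rcases hr.eq_or (D.t k) with h1 | h1 | ⟨g, hg, h1⟩
  · exact absurd (h1 ▸ ha.1) (D.t_mem k)
  · exact h1
  · have hne : e ≠ g := by rintro rfl; exact ht h1
    have hd := h.disjoint_maxSole (he ▸ ha) (he.trans hg.symm) hne
    obtain rfl := (h.sole_maxSole g).eq_of_enters k (hd.notMem_of_mem_left hs) h1
    exact absurd (he.trans hg.symm ▸ hs) (h.sole_maxSole e).s_notMem

theorem IsMinimal.exists_s_mem_maxSole (h : D.IsMinimal) {a r : V} (hr : D.Mate a r) {k : ε}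
    (hk : D.t k = r) : ∃ g, D.s g = a ∧ D.s k ∈ D.maxSole g := by
  rcases hr.eq_or (D.s k) with h1 | h1 | h1
  · exact absurd ⟨k, h1, hk ▸ (h.sole_maxSole k).t_mem⟩ hr.notMem_fan
  · exact absurd (h1.trans hk.symm) (s_ne_t _ _)
  · exact h1

theorem IsMinimal.exists_leaves_maxSole (h : D.IsMinimal) (e : ε) :
    ∃ k, D.s k ∈ D.maxSole e ∧ D.t k ∉ D.maxSole e :=
  h.exists_leaves (h.sole_maxSole e).balanced ⟨_, (h.sole_maxSole e).t_mem⟩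
    fun hu => (h.sole_maxSole e).s_notMem (hu.ge (Set.mem_univ _))

/-- Each of the disjoint sets `maxSole e` at `a` is left by an edge ending at `r`, and these edges
have distinct tails. -/
theorem IsMinimal.ncard_le_of_mate (h : D.IsMinimal) {a r : V} (ha : a ∈ D.A3) (hr : D.Mate a r) :
    {e | D.s e = a}.ncard ≤ {e | D.t e = r}.ncard := by
  choose ψ hψ hψ' using h.exists_leaves_maxSole
  refine Set.ncard_le_ncard_of_injOn ψ (fun e he => h.t_eq_of_leaves ha hr he (hψ e) (hψ' e)) ?_
    (Set.toFinite _)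
  intro e he f hf hef
  by_contra hne
  exact (h.disjoint_maxSole (he.symm ▸ ha) (he.trans hf.symm) hne).notMem_of_mem_left (hψ e)
    (hef ▸ hψ f)

/-- Only `f` enters `Wᶜ`, and `f` starts in `maxSole e`, so at most `e` enters the balanced set
`maxSole e ∪ Wᶜ`. If `e` does not, the union is everything, as wanted; if it does, maximality puts
`t f` in `maxSole e`, a contradiction. -/
theorem IsMinimal.subset_maxSole_of_swap (h : D.IsMinimal) {e f : ε} (hs : D.s f ∈ D.maxSole e)
    (ht : D.t f ∉ D.maxSole e) {W : Set V} (hW : D.swap.Sole f W) : W ⊆ D.maxSole e := by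
  have hZe := h.sole_maxSole e
  have hZ := Sole.of_swap h hW
  obtain ⟨M, hM, heM⟩ := h.exists_isPM_notMem e
  have hcl := hZe.closed hM heM
  have hfM : f ∉ M := fun h' => ht ((hcl f h').mp hs)
  have hb := hM.balanced (hcl.union (hZ.closed hM hfM))
  have henter : ∀ k, D.s k ∉ D.maxSole e ∪ Wᶜ → D.t k ∈ D.maxSole e ∪ Wᶜ → k = e := by
    intro k hk1 hk2
    rw [Set.mem_union, not_or] at hk1
    rcases hk2 with hk2 | hk2
    · exact hZe.eq_of_enters k hk1.1 hk2
    · obtain rfl := hZ.eq_of_enters k hk1.2 hk2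
      exact absurd hs hk1.1
  by_cases hse : D.s e ∈ Wᶜ
  · have hu : D.maxSole e ∪ Wᶜ = Set.univ := by
      by_contra hu
      obtain ⟨k, hk1, hk2⟩ := h.exists_enters _ hb ⟨_, .inl hZe.t_mem⟩ hu
      obtain rfl := henter k hk1 hk2
      exact hk1 (.inr hse)
    intro v hv
    rcases hu.ge (Set.mem_univ v) with h1 | h1
    · exact h1
    · exact absurd hv h1
  · have hsole : D.Sole e (D.maxSole e ∪ Wᶜ) :=
      ⟨hb, not_or.mpr ⟨hZe.s_notMem, hse⟩, .inl hZe.t_mem, henter⟩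
    exact absurd (hsole.subset_maxSole (.inr hZ.t_mem)) ht

theorem IsMinimal.mem_A3_swap (h : D.IsMinimal) {a r : V} (ha : a ∈ D.A3) (hr : D.Mate a r) :
    r ∈ D.swap.A3 :=
  ⟨hr.notMem, ha.2.trans (h.ncard_le_of_mate ha hr)⟩

theorem IsMinimal.ncard_eq_of_mate (h : D.IsMinimal) (hD' : D.swap.Tight) {a r : V}
    (ha : a ∈ D.A3) (hr : D.Mate a r) : {e | D.s e = a}.ncard = {e | D.t e = r}.ncard := by
  refine (h.ncard_le_of_mate ha hr).antisymm ?_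
  have hr3 := h.mem_A3_swap ha hr
  obtain ⟨a', ha'⟩ := h.swap.exists_mate hD' hr3
  -- Being a mate is symmetric: if `a` lay in the fan of `r` in the swapped graph,
  -- `subset_maxSole_of_swap` would place `a` in some `maxSole g` with `g` at `a`.
  have haa' : a = a' := by
    rcases ha'.eq_or a with h1 | h1 | ⟨f, hf, h1⟩
    · exact absurd (h1 ▸ ha.1) hr.notMem
    · exact h1
    · change D.t f = r at hf
      obtain ⟨g, hg, hfg⟩ := h.exists_s_mem_maxSole hr hf
      have hrg : D.t f ∉ D.maxSole g := fun h' => hr.notMem_fan ⟨g, hg, hf ▸ h'⟩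
      have := h.subset_maxSole_of_swap hfg hrg (h.swap.sole_maxSole f) h1
      exact absurd (hg ▸ this) (h.sole_maxSole g).s_notMem
  subst haa'
  exact h.swap.ncard_le_of_mate hr3 ha'

/-- Pigeonhole: `a` and `r` have equal degree, so choosing one leaving edge per set already exhausts
the edges at `r`. -/
theorem IsMinimal.eq_of_leaves (h : D.IsMinimal) (hD' : D.swap.Tight) {a r : V}
    (ha : a ∈ D.A3) (hr : D.Mate a r) {e k l : ε} (he : D.s e = a)
    (hk : D.s k ∈ D.maxSole e ∧ D.t k ∉ D.maxSole e)
    (hl : D.s l ∈ D.maxSole e ∧ D.t l ∉ D.maxSole e) : k = l := by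
  choose ψ hψ hψ' using h.exists_leaves_maxSole
  have hdisj : ∀ {e f : ε}, D.s e = a → D.s f = a → ∀ {v}, v ∈ D.maxSole e → v ∈ D.maxSole f →
      e = f := by
    intro e f he hf v hv hv'
    by_contra hne
    exact (h.disjoint_maxSole (he.symm ▸ ha) (he.trans hf.symm) hne).notMem_of_mem_left hv hv'
  have hsurj : ψ '' {e | D.s e = a} = {e | D.t e = r} := by
    refine Set.eq_of_subset_of_ncard_le ?_ ?_ (Set.toFinite _)
    · rintro _ ⟨g, hg, rfl⟩
      exact h.t_eq_of_leaves ha hr hg (hψ g) (hψ' g)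
    · rw [Set.InjOn.ncard_image, h.ncard_eq_of_mate hD' ha hr]
      exact fun g hg g' hg' hgg' => hdisj hg hg' (hψ g) (hgg' ▸ hψ g')
  have key : ∀ k, D.s k ∈ D.maxSole e ∧ D.t k ∉ D.maxSole e → k = ψ e := by
    intro k hk
    obtain ⟨g, hg, rfl⟩ := hsurj.ge (h.t_eq_of_leaves ha hr he hk.1 hk.2)
    rw [hdisj he hg hk.1 (hψ g)]
  rw [key k hk, key l hl]

theorem IsMinimal.exists_two_cut (h : D.IsMinimal) (hD : D.Tight) (hD' : D.swap.Tight) {e : ε}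
    (hs : D.s e ∈ D.A3) (ht : D.t e ∈ D.swap.A3) :
    ∃ f, D.s f ∈ D.A3 ∧ D.t f ∈ D.swap.A3 ∧ ∃ W : Set V,
      (∀ k, D.s k ∉ W ∧ D.t k ∈ W ↔ k = e) ∧ (∀ k, D.s k ∈ W ∧ D.t k ∉ W ↔ k = f) := by
  obtain ⟨r, hr⟩ := h.exists_mate hD hs
  obtain ⟨f, hf⟩ := h.exists_leaves_maxSole e
  have hleave : ∀ k, D.s k ∈ D.maxSole e → D.t k ∉ D.maxSole e → k = f := fun k h1 h2 =>
    h.eq_of_leaves hD' hs hr rfl ⟨h1, h2⟩ hf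
  have hfr : D.t f = r := h.t_eq_of_leaves hs hr rfl hf.1 hf.2
  have hZ := h.sole_maxSole e
  refine ⟨f, ?_, hfr ▸ h.mem_A3_swap hs hr, D.maxSole e,
    fun k => ⟨fun hk => hZ.eq_of_enters k hk.1 hk.2, ?_⟩, fun k => ⟨fun hk => hleave k hk.1 hk.2, ?_⟩⟩
  rotate_left
  · rintro rfl; exact ⟨hZ.s_notMem, hZ.t_mem⟩
  · rintro rfl; exact hf
  -- It remains to show that the tail of `f` has degree at least three.
  by_contra hf3
  have hre : D.cls (D.t e) ≠ D.cls r := cls_s hs ▸ h.cls_ne_of_notMem_fan hs hr.notMem hr.notMem_fan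
  have hcls : ∀ y ∈ D.maxSole e, y ∉ D.A → D.cls y = D.cls (D.t e) := by
    intro y hy hyA
    by_contra hne
    have hyr : D.cls y = D.cls r := cls_eq_or hD (D.t_mem e) hyA hr.notMem (Ne.symm hne) hre
    -- No forest edge crosses this set: only `e` and `f` cross the boundary of `maxSole e`, `f` is
    -- not a forest edge by assumption, and `e` lies in the excluded class.
    have : r ∈ {v | v ∈ D.maxSole e ∧ D.cls v ≠ D.cls (D.t e)} := by
      refine (mem_iff_of_cls_eq (fun k hk => ?_) hyr).mp ⟨hy, hne⟩
      change (_ ∧ _) ↔ (_ ∧ _)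
      rw [cls_s hk]
      refine and_congr_left fun hke => ⟨fun h1 => ?_, fun h1 => ?_⟩
      · by_contra h2
        exact hf3 (hleave k h1 h2 ▸ hk)
      · refine hZ.s_mem_of_ne h1 ?_
        rintro rfl
        exact hke rfl
    exact hf.2 (hfr ▸ this.1)
  have hA2 : ∀ x ∈ D.maxSole e, x ∈ D.A → x ∉ D.A3 → x = D.s f := by
    intro x hx hxA hx3
    obtain ⟨k, rfl⟩ := h.exists_s_eq hxA
    obtain ⟨l, hne, hl⟩ := h.exists_ne k
    by_contra hxf
    have h1 : D.t k ∈ D.maxSole e := by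
      by_contra h2
      exact hxf (congrArg D.s (hleave k hx h2))
    have h2 : D.t l ∈ D.maxSole e := by
      by_contra h2
      exact hxf (hl ▸ congrArg D.s (hleave l (hl ▸ hx) h2))
    exact h.cls_ne hl.symm hne.symm hx3
      ((hcls _ h1 (D.t_mem k)).trans (hcls _ h2 (D.t_mem l)).symm)
  -- Removing `s f` leaves vertices of `A3` with all neighbours inside `maxSole e`, and one vertex
  -- fewer than on the other side: the forest count applies again.
  have hXf : (D.maxSole e ∩ D.A) \ {D.s f} = ∅ := by
    refine h.eq_empty_of_edges (Y := D.maxSole e \ D.A) ?_ ?_ ?_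
    · intro x hx
      by_contra hx3
      exact hx.2 (hA2 x hx.1.1 hx.1.2 hx3)
    · intro k hk
      refine ⟨?_, D.t_mem k⟩
      by_contra h2
      exact hk.2 (congrArg D.s (hleave k hk.1.1 h2))
    · have hmem : D.s f ∈ D.maxSole e ∩ D.A := ⟨hf.1, D.s_mem f⟩
      rw [Set.ncard_sdiff_singleton_add_one hmem]
      exact hZ.balanced.ge
  -- With `s f` the only vertex of `A` in `maxSole e`, and no parallel edges, `t e` has degree at
  -- most two.
  have hsub : {k | D.t k = D.t e} ⊆ insert e {k | D.t k = D.t e ∧ D.s k = D.s f} := by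
    intro k hk
    by_cases hke : k = e
    · exact .inl hke
    · refine .inr ⟨hk, ?_⟩
      by_contra h2
      exact hXf.le ⟨⟨hZ.s_mem_of_ne (hk.symm ▸ hZ.t_mem) hke, D.s_mem k⟩, h2⟩
  have h1 := (Set.ncard_le_ncard hsub (Set.toFinite _)).trans (Set.ncard_insert_le _ _)
  have h2 : {k | D.t k = D.t e ∧ D.s k = D.s f}.ncard ≤ 1 :=
    (Set.ncard_le_one (Set.toFinite _)).mpr fun k hk l hl =>
      h.eq_of_parallel (hk.2.trans hl.2.symm) (hk.1.trans hl.1.symm)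
  have h3 : 3 ≤ {k | D.t k = D.t e}.ncard := ht.2
  omega

end Bigraph

/-! ### Perfect matchings from entered balanced sets -/

namespace Bigraph
variable {V ε : Type*} {D : Bigraph V ε}

/-- Hall's theorem, applied after deleting both ends of `f`. A violating set `Y`, together with `s
f` and its neighbours through `F`, padded by vertices of `A` up to size |Y|, would be a proper
balanced set that no edge of `F` enters. -/
theorem exists_isPM_of_enters [Finite V] {F : Set ε} (hu : D.Balanced Set.univ)
    (hF : ∀ Z, D.Balanced Z → Z.Nonempty → Z ≠ Set.univ → ∃ k ∈ F, D.s k ∉ Z ∧ D.t k ∈ Z)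
    {f : ε} (hf : f ∈ F) : ∃ M ⊆ F, D.IsPM M ∧ f ∈ M := by
  classical
  have := Fintype.ofFinite V
  let ι := {b : V // b ∉ D.A ∧ b ≠ D.t f}
  let N : ι → Finset V := fun b => {a | ∃ k ∈ F, D.t k = b ∧ D.s k = a ∧ a ≠ D.s f}
  have hA : D.A.ncard = D.Aᶜ.ncard := by
    simpa [Balanced, Set.compl_eq_univ_sdiff] using hu
  have hι : Nat.card ι + 1 = D.A.ncard := by
    rw [hA, ← Set.ncard_sdiff_singleton_add_one (show D.t f ∈ D.Aᶜ from D.t_mem f)]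
    rfl
  have hall : ∀ Y : Finset ι, Y.card ≤ (Y.biUnion N).card := by
    intro Y
    by_contra! hlt
    have hsub : insert (D.s f) (Y.biUnion N) ⊆ D.A.toFinset := by
      intro a ha
      simp only [Finset.mem_insert, Finset.mem_biUnion, N, Finset.mem_filter] at ha
      rw [Set.mem_toFinset]
      rcases ha with rfl | ⟨b, -, -, k, -, -, rfl, -⟩
      · exact D.s_mem f
      · exact D.s_mem k
    have hYA : Y.card ≤ D.A.toFinset.card := by
      have h1 : Y.card ≤ Nat.card ι := by
        rw [Nat.card_eq_fintype_card]
        exact Finset.card_le_univ Y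
      rw [← Set.ncard_eq_toFinset_card']
      omega
    obtain ⟨X, hX1, hX2, hX3⟩ := Finset.exists_subsuperset_card_eq hsub
      ((Finset.card_insert_le _ _).trans hlt) hYA
    have hXA : ∀ a ∈ X, a ∈ D.A := fun a ha => Set.mem_toFinset.mp (hX2 ha)
    let Y' : Finset V := Y.map (Function.Embedding.subtype _)
    have hY' : ∀ b ∈ Y', b ∉ D.A ∧ b ≠ D.t f := by
      intro b hb
      obtain ⟨b, -, rfl⟩ := Finset.mem_map.mp hb
      exact b.2
    have h1 : (↑X ∪ ↑Y' : Set V) ∩ D.A = X := by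
      ext v
      constructor
      · rintro ⟨hv | hv, hvA⟩
        · exact hv
        · exact absurd hvA (hY' v hv).1
      · exact fun hv => ⟨.inl hv, hXA v hv⟩
    have h2 : (↑X ∪ ↑Y' : Set V) \ D.A = Y' := by
      ext v
      constructor
      · rintro ⟨hv | hv, hvA⟩
        · exact absurd (hXA v hv) hvA
        · exact hv
      · exact fun hv => ⟨.inr hv, (hY' v hv).1⟩
    have hsX : D.s f ∈ X := hX1 (Finset.mem_insert_self _ _)
    obtain ⟨k, hk, hks, hkt⟩ := hF (↑X ∪ ↑Y') (by
        rw [Balanced, h1, h2, Set.ncard_coe_finset, Set.ncard_coe_finset, hX3, Finset.card_map])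
      ⟨D.s f, .inl hsX⟩ (fun hu' => by
        rcases hu'.ge (Set.mem_univ (D.t f)) with h3 | h3
        · exact D.t_mem f (hXA _ h3)
        · exact (hY' _ h3).2 rfl)
    rw [Set.mem_union, not_or] at hks
    rcases hkt with h3 | h3
    · exact D.t_mem k (hXA _ h3)
    · obtain ⟨b, hb, hbk⟩ := Finset.mem_map.mp h3
      refine hks.1 (hX1 (Finset.mem_insert_of_mem (Finset.mem_biUnion.mpr ⟨b, hb, ?_⟩)))
      simp only [N, Finset.mem_filter, Finset.mem_univ, true_and]
      exact ⟨k, hk, hbk.symm, rfl, fun h4 => hks.1 (h4 ▸ hsX)⟩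
  obtain ⟨g, hg, hgN⟩ := (Finset.all_card_le_biUnion_card_iff_exists_injective N).mp hall
  simp only [N, Finset.mem_filter, Finset.mem_univ, true_and] at hgN
  choose κ hκF hκt hκs hκf using hgN
  have hrange : Set.range g = D.A \ {D.s f} := by
    refine Set.eq_of_subset_of_ncard_le ?_ ?_ (Set.toFinite _)
    · rintro _ ⟨b, rfl⟩
      exact ⟨hκs b ▸ D.s_mem _, hκf b⟩
    · have h1 := Set.ncard_sdiff_singleton_add_one (D.s_mem f)
      have h2 : (Set.range g).ncard = Nat.card ι := by
        rw [← Set.image_univ, Set.ncard_image_of_injective _ hg, Set.ncard_univ]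
      omega
  refine ⟨insert f (Set.range κ), ?_, fun v => ?_, .inl rfl⟩
  · rintro _ (rfl | ⟨b, rfl⟩)
    · exact hf
    · exact hκF b
  · by_cases hv : v ∈ D.A
    · by_cases hvf : v = D.s f
      · refine ⟨f, ⟨.inl rfl, .inl hvf.symm⟩, ?_⟩
        rintro k ⟨rfl | ⟨b, rfl⟩, h1 | h1⟩
        · rfl
        · rfl
        · exact absurd ((hκs b).symm.trans (h1.trans hvf)) (hκf b)
        · exact absurd (h1 ▸ hv) (D.t_mem _)
      · obtain ⟨b, rfl⟩ := hrange.ge ⟨hv, hvf⟩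
        refine ⟨κ b, ⟨.inr ⟨b, rfl⟩, .inl (hκs b)⟩, ?_⟩
        rintro k ⟨rfl | ⟨b', rfl⟩, h1 | h1⟩
        · exact absurd h1.symm hvf
        · exact absurd (h1 ▸ hv) (D.t_mem _)
        · rw [hκs b'] at h1
          rw [hg h1]
        · exact absurd (h1 ▸ hv) (D.t_mem _)
    · by_cases hvf : v = D.t f
      · refine ⟨f, ⟨.inl rfl, .inr hvf.symm⟩, ?_⟩
        rintro k ⟨rfl | ⟨b, rfl⟩, h1 | h1⟩
        · rfl
        · rfl
        · exact absurd (h1 ▸ D.s_mem _) hv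
        · exact absurd ((hκt b).symm.trans (h1.trans hvf)) b.2.2
      · refine ⟨κ ⟨v, hv, hvf⟩, ⟨.inr ⟨_, rfl⟩, .inr (hκt _)⟩, ?_⟩
        rintro k ⟨rfl | ⟨b, rfl⟩, h1 | h1⟩
        · exact absurd (h1 ▸ D.s_mem _) hv
        · exact absurd h1.symm hvf
        · exact absurd (h1 ▸ D.s_mem _) hv
        · congr 1
          exact Subtype.ext ((hκt b).symm.trans h1)

/-- Connectivity by edges of `F`: a set crossed by no edge of `F` is balanced through the matching,
so if proper and nonempty it would be entered. -/
theorem eq_univ_of_closed {F : Set ε}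
    (hF : ∀ Z, D.Balanced Z → Z.Nonempty → Z ≠ Set.univ → ∃ k ∈ F, D.s k ∉ Z ∧ D.t k ∈ Z)
    {M : Set ε} (hM : D.IsPM M) (hMF : M ⊆ F) {C : Set V} (hC : D.Closed F C) (hne : C.Nonempty) :
    C = Set.univ := by
  by_contra hu
  obtain ⟨k, hk, h1, h2⟩ := hF C (hM.balanced fun k hk => hC k (hMF hk)) hne hu
  exact h1 ((hC k hk).mpr h2)

end Bigraph

/-! ### Translation between `Graph` and `Bigraph` -/

namespace Graph

variable {α β : Type*} {G : Graph α β} {A B : Set α}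

theorem IsBipartiteWith.exists_isLink (hAB : G.IsBipartiteWith A B) (e : E(G)) :
    ∃ x y : V(G), G.IsLink e x y ∧ (x : α) ∈ A ∧ (y : α) ∈ B := by
  obtain ⟨x, y, hxy⟩ := G.exists_isLink_of_mem_edgeSet e.2
  rcases hAB.isLink e x y hxy with ⟨h1, h2⟩ | ⟨h1, h2⟩
  · exact ⟨⟨x, hxy.left_mem⟩, ⟨y, hxy.right_mem⟩, hxy, h1, h2⟩
  · exact ⟨⟨y, hxy.right_mem⟩, ⟨x, hxy.left_mem⟩, hxy.symm, h2, h1⟩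

/-- A bipartite graph, with its edges directed from `A` to `B`. -/
noncomputable def IsBipartiteWith.bigraph (hAB : G.IsBipartiteWith A B) : Bigraph V(G) E(G) where
  s e := (hAB.exists_isLink e).choose
  t e := (hAB.exists_isLink e).choose_spec.choose
  A := {v | (v : α) ∈ A}
  s_mem e := (hAB.exists_isLink e).choose_spec.choose_spec.2.1
  t_mem e h := hAB.disjoint.notMem_of_mem_left h (hAB.exists_isLink e).choose_spec.choose_spec.2.2

namespace IsBipartiteWith

theorem mem_A (hAB : G.IsBipartiteWith A B) {v : V(G)} : v ∈ hAB.bigraph.A ↔ (v : α) ∈ A := .rfl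

theorem notMem_A (hAB : G.IsBipartiteWith A B) {v : V(G)} : v ∉ hAB.bigraph.A ↔ (v : α) ∈ B := by
  rw [hAB.mem_A]
  constructor
  · intro h
    have : (v : α) ∈ A ∪ B := hAB.union_eq.ge v.2
    exact this.resolve_left h
  · exact fun h h' => hAB.disjoint.notMem_of_mem_left h' h

theorem isLink_bigraph (hAB : G.IsBipartiteWith A B) (e : E(G)) :
    G.IsLink e (hAB.bigraph.s e) (hAB.bigraph.t e) :=
  (hAB.exists_isLink e).choose_spec.choose_spec.1

theorem inc_iff (hAB : G.IsBipartiteWith A B) {e : E(G)} {v : V(G)} :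
    G.Inc e v ↔ hAB.bigraph.s e = v ∨ hAB.bigraph.t e = v := by
  constructor
  · intro h
    exact (h.eq_or_eq_of_isLink (hAB.isLink_bigraph e)).imp (fun h => Subtype.ext h.symm)
      (fun h => Subtype.ext h.symm)
  · rintro (rfl | rfl)
    · exact (hAB.isLink_bigraph e).inc_left
    · exact (hAB.isLink_bigraph e).inc_right

theorem isLink_iff (hAB : G.IsBipartiteWith A B) {e : E(G)} {x y : V(G)} :
    G.IsLink e x y ↔ (hAB.bigraph.s e = x ∧ hAB.bigraph.t e = y) ∨
      (hAB.bigraph.s e = y ∧ hAB.bigraph.t e = x) := by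
  rw [(hAB.isLink_bigraph e).isLink_iff]
  simp only [← Subtype.ext_iff]

theorem isPM_preimage (hAB : G.IsBipartiteWith A B) {N : Set β} (hN : G.IsPerfectMatching N) :
    hAB.bigraph.IsPM (Subtype.val ⁻¹' N) := by
  intro v
  obtain ⟨e, ⟨he, hev⟩, huniq⟩ := hN.2 v v.2
  exact ⟨⟨e, hN.1 he⟩, ⟨he, hAB.inc_iff.mp hev⟩,
    fun f hf => Subtype.ext (huniq f ⟨hf.1, hAB.inc_iff.mpr hf.2⟩)⟩

theorem isPerfectMatching_image (hAB : G.IsBipartiteWith A B) {e : E(G)} {M : Set E(G)}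
    (hM : hAB.bigraph.IsPM M) (heM : e ∉ M) :
    (G.deleteEdges {(e : β)}).IsPerfectMatching (Subtype.val '' M) := by
  have hne : ∀ f ∈ M, (f : β) ≠ e := fun f hf h => heM (Subtype.ext h ▸ hf)
  constructor
  · rintro _ ⟨f, hf, rfl⟩
    exact ⟨f.2, hne f hf⟩
  · intro v hv
    obtain ⟨f, ⟨hf, hfv⟩, huniq⟩ := hM ⟨v, hv⟩
    refine ⟨f, ⟨⟨f, hf, rfl⟩, deleteEdges_inc.mpr ⟨hAB.inc_iff.mpr hfv, hne f hf⟩⟩, ?_⟩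
    rintro _ ⟨⟨k, hk, rfl⟩, hkv⟩
    exact congrArg Subtype.val (huniq k ⟨hk, hAB.inc_iff.mp (deleteEdges_inc.mp hkv).1⟩)

/-- If no edge entered `Z`, the perfect matching through any given edge would show that this edge
does not leave `Z` either, contradicting connectedness. -/
theorem exists_enters (hAB : G.IsBipartiteWith A B) [Finite V(G)] [Finite E(G)]
    (hG : G.IsMatchingCovered) {Z : Set V(G)} (hZ : hAB.bigraph.Balanced Z) (hne : Z.Nonempty)
    (hu : Z ≠ Set.univ) : ∃ e, hAB.bigraph.s e ∉ Z ∧ hAB.bigraph.t e ∈ Z := by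
  by_contra! hcon
  have hcl : ∀ e, hAB.bigraph.s e ∈ Z ↔ hAB.bigraph.t e ∈ Z := by
    intro e
    obtain ⟨N, hN, he⟩ := hG.matchable e e.2
    exact (hAB.isPM_preimage hN).closed hZ
      (fun k _ hk => by by_contra h'; exact hcon k h' hk) e he
  obtain ⟨x, hx⟩ := hne
  refine hu (Set.eq_univ_of_forall fun y => ?_)
  have hreach := hG.connected.2 x x.2 y y.2
  have key : ∀ z, Relation.ReflTransGen G.Adj x z → ∃ hz : z ∈ V(G), (⟨z, hz⟩ : V(G)) ∈ Z := by
    intro z hz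
    induction hz with
    | refl => exact ⟨x.2, hx⟩
    | @tail b c _ hbc ih =>
      obtain ⟨hb, hbZ⟩ := ih
      obtain ⟨e, he⟩ := hbc
      refine ⟨he.right_mem, ?_⟩
      rcases (hAB.isLink_iff (e := ⟨e, he.edge_mem⟩) (x := ⟨b, hb⟩)
        (y := ⟨c, he.right_mem⟩)).mp he with ⟨h1, h2⟩ | ⟨h1, h2⟩
      · exact h2 ▸ (hcl _).mp (h1 ▸ hbZ)
      · exact h1 ▸ (hcl _).mpr (h2 ▸ hbZ)
  exact (key y hreach).2

/-- If `e` were nowhere the sole entering edge, every proper nonempty balanced set would be entered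
by an edge other than `e`; Hall's theorem then makes the graph without `e` matching covered. -/
theorem isMinimal_bigraph (hAB : G.IsBipartiteWith A B) [Finite V(G)] [Finite E(G)]
    (hG : G.IsMinimalMatchingCovered) (e₀ : E(G)) : hAB.bigraph.IsMinimal := by
  have hcov : ∀ e, ∃ M, hAB.bigraph.IsPM M ∧ e ∈ M := fun e =>
    let ⟨_, hN, he⟩ := hG.matchingCovered.matchable e e.2
    ⟨_, hAB.isPM_preimage hN, he⟩
  have huniv : hAB.bigraph.Balanced Set.univ :=
    let ⟨_, hM, _⟩ := hcov e₀
    hM.balanced fun e _ => by simp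
  refine ⟨⟨e₀⟩, hcov, fun Z hZ hne hu => hAB.exists_enters hG.matchingCovered hZ hne hu, fun e => ?_⟩
  by_contra! hcon
  have hF : ∀ Z, hAB.bigraph.Balanced Z → Z.Nonempty → Z ≠ Set.univ →
      ∃ k ∈ {k | k ≠ e}, hAB.bigraph.s k ∉ Z ∧ hAB.bigraph.t k ∈ Z := by
    intro Z hZ hne hu
    by_contra! h1
    have h2 : ∀ k, hAB.bigraph.s k ∉ Z → hAB.bigraph.t k ∈ Z → k = e := fun k hk1 hk2 => by
      by_contra hke
      exact h1 k hke hk1 hk2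
    obtain ⟨k, hk1, hk2⟩ := hAB.exists_enters hG.matchingCovered hZ hne hu
    obtain rfl := h2 k hk1 hk2
    exact hcon Z ⟨hZ, hk1, hk2, h2⟩
  have hb : hAB.bigraph.Balanced {hAB.bigraph.s e, hAB.bigraph.t e} := by
    have h1 := hAB.bigraph.s_mem e
    have h2 := hAB.bigraph.t_mem e
    rw [Bigraph.Balanced, Set.insert_inter_of_mem h1, Set.insert_sdiff_of_mem _ h1,
      Set.singleton_inter_eq_empty.mpr h2, (Set.disjoint_singleton_left.mpr h2).sdiff_eq_left]
    simp
  have hne : ({hAB.bigraph.s e, hAB.bigraph.t e} : Set V(G)) ≠ Set.univ := by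
    intro hu
    have h1 := hG.matchingCovered.four_le_order
    have h2 : Nat.card V(G) = V(G).ncard := rfl
    rw [← h2, ← Set.ncard_univ, ← hu] at h1
    have h3 := Set.ncard_insert_le (hAB.bigraph.s e) {hAB.bigraph.t e}
    rw [Set.ncard_singleton] at h3
    omega
  -- Four vertices make the ends of `e` a proper balanced set; this yields an edge other than `e`,
  -- hence a perfect matching avoiding `e`, which the connectivity argument needs.
  obtain ⟨f₀, hf₀, -⟩ := hF _ hb ⟨_, .inl rfl⟩ hne
  obtain ⟨M₀, hM₀F, hM₀, -⟩ := Bigraph.exists_isPM_of_enters huniv hF hf₀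
  refine hG.not_deleteEdges e e.2 ⟨⟨hG.matchingCovered.connected.1, fun x hx y hy => ?_⟩,
    hG.matchingCovered.four_le_order, fun f hf => ?_⟩
  · have hC := Bigraph.eq_univ_of_closed hF hM₀ hM₀F
      (C := {v : V(G) | Relation.ReflTransGen (G.deleteEdges {(e : β)}).Adj x v}) (fun k hk => ?_)
      ⟨⟨x, hx⟩, .refl⟩
    · exact hC.ge (Set.mem_univ (⟨y, hy⟩ : V(G)))
    · have hlink : (G.deleteEdges {(e : β)}).IsLink k (hAB.bigraph.s k) (hAB.bigraph.t k) := by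
        rw [deleteEdges_isLink]
        exact ⟨hAB.isLink_bigraph k, fun h => hk (Subtype.ext h)⟩
      exact ⟨fun h => h.tail ⟨k, hlink⟩, fun h => h.tail ⟨k, hlink.symm⟩⟩
  · obtain ⟨M, hMF, hM, hfM⟩ := Bigraph.exists_isPM_of_enters huniv hF (f := ⟨f, hf.1⟩)
      (fun h => hf.2 (congrArg Subtype.val h))
    exact ⟨_, hAB.isPerfectMatching_image hM (fun h => hMF h rfl), _, hfM, rfl⟩

theorem degree_eq (hAB : G.IsBipartiteWith A B) (v : V(G)) :
    G.degree v = {e | hAB.bigraph.s e = v ∨ hAB.bigraph.t e = v}.ncard := by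
  have hloop : G.loopSet v = ∅ := by
    refine Set.eq_empty_of_forall_notMem fun e he => ?_
    rcases hAB.isLink e v v he with ⟨h1, h2⟩ | ⟨h1, h2⟩
    · exact hAB.disjoint.notMem_of_mem_left h1 h2
    · exact hAB.disjoint.notMem_of_mem_left h2 h1
  have hinc : G.incidenceSet v =
      Subtype.val '' {e | hAB.bigraph.s e = v ∨ hAB.bigraph.t e = v} := by
    ext e
    constructor
    · intro he
      exact ⟨⟨e, he.edge_mem⟩, hAB.inc_iff.mp he, rfl⟩
    · rintro ⟨e, he, rfl⟩
      exact hAB.inc_iff.mpr he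
  rw [degree, hloop, hinc, Set.ncard_empty, add_zero,
    Set.ncard_image_of_injective _ Subtype.val_injective]

theorem degree_of_mem (hAB : G.IsBipartiteWith A B) {v : V(G)} (hv : v ∈ hAB.bigraph.A) :
    G.degree v = {e | hAB.bigraph.s e = v}.ncard := by
  rw [hAB.degree_eq]
  congr 1
  ext e
  exact or_iff_left fun h => hAB.bigraph.t_mem e (h ▸ hv)

theorem degree_of_notMem (hAB : G.IsBipartiteWith A B) {v : V(G)} (hv : v ∉ hAB.bigraph.A) :
    G.degree v = {e | hAB.bigraph.t e = v}.ncard := by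
  rw [hAB.degree_eq]
  congr 1
  ext e
  exact or_iff_right fun h => hv (h ▸ hAB.bigraph.s_mem e)

theorem isThreeEdge_iff (hAB : G.IsBipartiteWith A B) (e : E(G)) : G.IsThreeEdge e ↔
    hAB.bigraph.s e ∈ hAB.bigraph.A3 ∧ hAB.bigraph.t e ∈ hAB.bigraph.swap.A3 := by
  have hs := hAB.bigraph.s_mem e
  have ht := hAB.bigraph.t_mem e
  constructor
  · intro h
    exact ⟨⟨hs, hAB.degree_of_mem hs ▸ h.2 _ (hAB.inc_iff.mpr (.inl rfl))⟩,
      ⟨ht, hAB.degree_of_notMem ht ▸ h.2 _ (hAB.inc_iff.mpr (.inr rfl))⟩⟩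
  · rintro ⟨h1, h2⟩
    refine ⟨e.2, fun v hv => ?_⟩
    rcases (hAB.inc_iff (v := ⟨v, hv.vertex_mem⟩)).mp hv with h | h
    · have := hAB.degree_of_mem hs ▸ h1.2
      rwa [h] at this
    · have : 3 ≤ {k | hAB.bigraph.t k = hAB.bigraph.t e}.ncard := h2.2
      rw [← hAB.degree_of_notMem ht] at this
      rwa [h] at this

theorem ncard_degreeTwoVerts (hAB : G.IsBipartiteWith A B) [Finite V(G)] [Finite E(G)]
    (h : hAB.bigraph.IsMinimal) : G.degreeTwoVerts.ncard =
      (hAB.bigraph.A \ hAB.bigraph.A3).ncard + (hAB.bigraph.swap.A \ hAB.bigraph.swap.A3).ncard := by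
  have hset : G.degreeTwoVerts = Subtype.val '' ((hAB.bigraph.A \ hAB.bigraph.A3) ∪
      (hAB.bigraph.swap.A \ hAB.bigraph.swap.A3)) := by
    have hiff : ∀ v : V(G), G.degree v = 2 ↔ v ∈ (hAB.bigraph.A \ hAB.bigraph.A3) ∪
        (hAB.bigraph.swap.A \ hAB.bigraph.swap.A3) := by
      intro v
      by_cases hv : v ∈ hAB.bigraph.A
      · have h2 := h.two_le_degree hv
        have hv' : v ∉ hAB.bigraph.swap.A := fun h' => h' hv
        simp only [Set.mem_union, Set.mem_sdiff, hv, hv', false_and, or_false, true_and,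
          Bigraph.A3, Set.mem_ofPred_eq]
        rw [hAB.degree_of_mem hv]
        omega
      · have hv' : v ∈ hAB.bigraph.swap.A := hv
        have h2 : 2 ≤ {e | hAB.bigraph.t e = v}.ncard := h.swap.two_le_degree hv'
        have h3 : v ∈ hAB.bigraph.swap.A3 ↔ 3 ≤ {e | hAB.bigraph.t e = v}.ncard :=
          ⟨fun h => h.2, fun h => ⟨hv', h⟩⟩
        simp only [Set.mem_union, Set.mem_sdiff, hv, hv', false_and, false_or, true_and, h3]
        rw [hAB.degree_of_notMem hv]
        omega
    ext v
    constructor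
    · rintro ⟨hv, h2⟩
      exact ⟨⟨v, hv⟩, (hiff ⟨v, hv⟩).mp h2, rfl⟩
    · rintro ⟨v, hv, rfl⟩
      exact ⟨v.2, (hiff v).mpr hv⟩
  rw [hset, Set.ncard_image_of_injective _ Subtype.val_injective, Set.ncard_union_eq]
  exact Set.disjoint_left.mpr fun v h1 h2 => h2.1 h1.1

end IsBipartiteWith

end Graph

/-! ### The balanced 2-cut property -/

theorem theorem4p3 {α β : Type*} (G : Graph α β) (hG : G.IsTwoVertexExtremal)
    (A B : Set α) (hAB : G.IsBipartiteWith A B) (e : β) (he : G.IsThreeEdge e) :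
    ∃ f : β, f ≠ e ∧ G.IsThreeEdge f ∧
      ∃ W ⊆ V(G), G.cut W = {e, f} ∧ G.IsBalancedCut A B W := by
  have : Finite V(G) := hG.finite_vertexSet
  have : Finite E(G) := hG.finite_edgeSet
  lift e to E(G) using he.1
  have hmin := hAB.isMinimal_bigraph hG.minimal e
  -- Each colour class has at least m - n + 2 vertices of degree two; the extremal total forces
  -- equality in both.
  obtain ⟨hD, hD'⟩ : hAB.bigraph.Tight ∧ hAB.bigraph.swap.Tight := by
    have h1 := hmin.add_two_le
    have h2 := hmin.swap.add_two_le
    have h3 := hmin.card_edges_add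
    have h4 := hmin.swap.card_edges_add
    have h5 := hG.extremal
    rw [hAB.ncard_degreeTwoVerts hmin, ← Nat.card_coe_set_eq E(G), ← Nat.card_coe_set_eq V(G)] at h5
    rw [Bigraph.Tight, Bigraph.Tight]
    omega
  obtain ⟨hs, ht⟩ := (hAB.isThreeEdge_iff e).mp he
  obtain ⟨f, hsf, htf, W, hin, hout⟩ := hmin.exists_two_cut hD hD' hs ht
  have hmem : ∀ k : E(G), ∀ x y : α, G.IsLink k x y → x ∈ (Subtype.val '' W : Set α) →
      y ∉ (Subtype.val '' W : Set α) → (x ∈ A ∧ k = f) ∨ (x ∈ B ∧ k = e) := by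
    rintro k _ y hk ⟨x, hx, rfl⟩ hy
    lift y to V(G) using hk.right_mem
    have hyW : y ∉ W := fun h => hy ⟨y, h, rfl⟩
    rcases hAB.isLink_iff.mp hk with ⟨rfl, rfl⟩ | ⟨rfl, rfl⟩
    · exact .inl ⟨hAB.bigraph.s_mem k, (hout k).mp ⟨hx, hyW⟩⟩
    · exact .inr ⟨hAB.notMem_A.mp (hAB.bigraph.t_mem k), (hin k).mp ⟨hyW, hx⟩⟩
  have hval : ∀ v : V(G), (v : α) ∈ (Subtype.val '' W : Set α) ↔ v ∈ W := fun v =>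
    Subtype.val_injective.mem_set_image
  have hfW := (hout f).mpr rfl
  have heW := (hin e).mpr rfl
  have hcutA : G.cutAt A (Subtype.val '' W) = {(f : β)} := by
    ext k
    constructor
    · rintro ⟨x, y, hk, hx, hy, hxA⟩
      rcases hmem ⟨k, hk.edge_mem⟩ x y hk hx hy with ⟨-, h⟩ | ⟨h, -⟩
      · exact congrArg Subtype.val h
      · exact absurd h (hAB.disjoint.notMem_of_mem_left hxA)
    · rintro rfl
      exact ⟨_, _, hAB.isLink_bigraph f, (hval _).mpr hfW.1, mt (hval _).mp hfW.2,
        hAB.bigraph.s_mem f⟩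
  have hcutB : G.cutAt B (Subtype.val '' W) = {(e : β)} := by
    ext k
    constructor
    · rintro ⟨x, y, hk, hx, hy, hxB⟩
      rcases hmem ⟨k, hk.edge_mem⟩ x y hk hx hy with ⟨h, -⟩ | ⟨-, h⟩
      · exact absurd hxB (hAB.disjoint.notMem_of_mem_left h)
      · exact congrArg Subtype.val h
    · rintro rfl
      exact ⟨_, _, (hAB.isLink_bigraph e).symm, (hval _).mpr heW.2, mt (hval _).mp heW.1,
        hAB.notMem_A.mp (hAB.bigraph.t_mem e)⟩
  refine ⟨f, ?_, (hAB.isThreeEdge_iff f).mpr ⟨hsf, htf⟩, Subtype.val '' W, ?_, ?_, ?_⟩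
  · intro hfe
    exact heW.1 (Subtype.ext hfe ▸ hfW.1)
  · rintro _ ⟨v, -, rfl⟩
    exact v.2
  · ext k
    constructor
    · rintro ⟨x, y, hk, hx, hy⟩
      rcases hmem ⟨k, hk.edge_mem⟩ x y hk hx hy with ⟨-, h⟩ | ⟨-, h⟩
      · exact .inr (congrArg Subtype.val h)
      · exact .inl (congrArg Subtype.val h)
    · rintro (rfl | rfl)
      · obtain ⟨x, y, hk, hx, hy, -⟩ := hcutB.ge rfl
        exact ⟨x, y, hk, hx, hy⟩
      · obtain ⟨x, y, hk, hx, hy, -⟩ := hcutA.ge rfl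
        exact ⟨x, y, hk, hx, hy⟩
  · rw [Graph.IsBalancedCut, hcutA, hcutB, Set.ncard_singleton, Set.ncard_singleton]
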